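/- Fix an integer $k\ge 2$. A $k$-AND clause on Boolean variables $x_1,\dots,x_n\in\{\pm1\}$ is a pair $(V^+,V^-)$ of disjoint subsets of $[n]$ with $|V^+\cup V^-|=k$; it is satisfied by $x$ if $x_v=+1$ for all $v\in V^+$ and $x_v=-1$ for all $v\in V^-$. An (unweighted) instance $\Psi$ of Max-$k$AND on $n$ variables is a nonempty list of such clauses, repetitions allowed; its value $\mathsf{val}_\Psi$ is the maximum over all $x\in\{\pm1\}^n$ of the fraction of clauses satisfied by $x$; its maximum degree is at most $D$ if every variable is contained in at most $D$ of its clauses (counted with multiplicity). Put $\gamma_k=\frac1k$ for odd $k$, $\gamma_k=\frac1{k+1}$ for even $k$, and \[ \alpha^*_k = 2^{-(k-1)}\,(1-\gamma_k)^{\lfloor k/2\rfloor}(1+\gamma_k)^{\lfloor k/2\rfloor}. \] A streaming algorithm with $s(n)$ bits of memory is a randomized one-pass algorithm which knows $n$, starts from a random memory state in $\{0,1\}^{s(n)}$, on each arriving clause moves to a new memory state drawn, with fresh independent randomness, from a distribution depending only on $n$, the current state and the clause, and at the end of the stream outputs a real number determined by $n$ and the final state. Theorem (bounded-degree streaming algorithm).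 For every $k\ge 2$ there exist $\alpha>\alpha^*_k$ and a constant $K>0$ (depending only on $k$) such that for every $\varepsilon>0$ and every integer $D\ge2$ there is a streaming algorithm using, for every $n$, at most \[ K\cdot \frac{D^{1/k}\, n^{1-1/k}\,\log n}{\varepsilon^{2/k}} \] bits of memory which, for every $n$ and every instance $\Psi$ of Max-$k$AND on $n$ variables with maximum degree at most $D$, given the clauses of $\Psi$ in an arbitrary (adversarial) order, outputs with probability at least $99/100$ a number $\hat v$ with \[ (\alpha-\varepsilon)\,\mathsf{val}_\Psi\le \hat v\le \mathsf{val}_\Psi . \] -/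

import Mathlib

/-- A `k`-AND clause on the Boolean variables `Fin n`: a set `pos` of variables required to be true
(value `+1`) and a disjoint set `neg` of variables required to be false (value `-1`), with exactly
`k` variables in total. -/
structure Clause (k n : ℕ) where
  pos : Finset (Fin n)
  neg : Finset (Fin n)
  disj : Disjoint pos neg
  card_eq : (pos ∪ neg).card = k

/-- The assignment `x` (`true` stands for `+1` and `false` for `-1`) satisfies the clause `C`. -/
def Clause.IsSat {k n : ℕ} (C : Clause k n) (x : Fin n → Bool) : Prop :=
  (∀ v ∈ C.pos, x v = true) ∧ (∀ v ∈ C.neg, x v = false)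

/-- An unweighted instance of Max-`k`AND on `n` variables, given as the list of its clauses. The
same clause may occur several times; the order is the order in which the clauses are streamed. -/
abbrev Instance (k n : ℕ) : Type := List (Clause k n)

namespace Instance

/-- The number of clauses, counted with multiplicity, in which the variable `v` occurs. -/
noncomputable def degree {k n : ℕ} (Ψ : Instance k n) (v : Fin n) : ℕ := by
  classical exact Ψ.countP (fun C => decide (v ∈ C.pos ∪ C.neg))

/-- Every variable is contained in at most `D` clauses. -/
def MaxDegreeLE {k n : ℕ} (Ψ : Instance k n) (D : ℕ) : Prop :=
  ∀ v : Fin n, Ψ.degree v ≤ D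

/-- The fraction of the clauses of `Ψ` satisfied by the assignment `x`. -/
noncomputable def valAt {k n : ℕ} (Ψ : Instance k n) (x : Fin n → Bool) : ℝ := by
  classical exact (Ψ.countP (fun C => decide (C.IsSat x)) : ℝ) / (Ψ.length : ℝ)

/-- The value of `Ψ`: the maximum over all assignments of the fraction of satisfied clauses. -/
noncomputable def val {k n : ℕ} (Ψ : Instance k n) : ℝ :=
  Finset.univ.sup' Finset.univ_nonempty (fun x : Fin n → Bool => Ψ.valAt x)

end Instance

/-- A randomized one-pass streaming algorithm for Max-`k`AND. On instances with `n` variables it has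
`space n` bits of memory. It starts from a random memory state; on every clause that arrives, the
new memory state is drawn, with fresh independent randomness, from a distribution that depends only
on the current memory state and on that clause; after the last clause it outputs a number that
depends only on the final memory state. In particular any randomness that is to be reused has to be
kept in the memory, and the number of clauses is not known in advance. -/
structure StreamingAlgorithm (k : ℕ) where
  /-- The number of bits of memory. -/
  space : ℕ → ℕ
  /-- The distribution of the initial memory state. -/
  init : ∀ n : ℕ, PMF (Fin (space n) → Bool)
  /-- The transition on the arrival of a clause. -/
  step : ∀ n : ℕ, (Fin (space n) → Bool) → Clause k n → PMF (Fin (space n) → Bool)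
  /-- The output after the end of the stream. -/
  output : ∀ n : ℕ, (Fin (space n) → Bool) → ℝ

namespace StreamingAlgorithm

/-- The distribution of the memory state after the clauses of `Ψ` have been read in order. -/
noncomputable def finalState {k : ℕ} (A : StreamingAlgorithm k) (n : ℕ) (Ψ : Instance k n) :
    PMF (Fin (A.space n) → Bool) :=
  Ψ.foldl (fun μ C => μ.bind (fun s => A.step n s C)) (A.init n)

/-- The distribution of the output on the stream `Ψ`. -/
noncomputable def outputDist {k : ℕ} (A : StreamingAlgorithm k) (n : ℕ) (Ψ : Instance k n) :
    PMF ℝ :=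
  (A.finalState n Ψ).map (A.output n)

/-- On the stream `Ψ`, the output `v` of `A` is, with probability at least `99/100`, an
`α`-approximation to the value of `Ψ`, that is, `α * val Ψ ≤ v ≤ val Ψ`. -/
def Approximates {k : ℕ} (A : StreamingAlgorithm k) (n : ℕ) (Ψ : Instance k n) (α : ℝ) : Prop :=
  99 / 100 ≤ (A.outputDist n Ψ).toMeasure (Set.Icc (α * Ψ.val) Ψ.val)

end StreamingAlgorithm

/-- `γ_k`: this is `1 / k` for odd `k` and `1 / (k + 1)` for even `k`. -/
noncomputable def gammaK (k : ℕ) : ℝ :=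
  if Odd k then 1 / (k : ℝ) else 1 / ((k : ℝ) + 1)

/-- `α*_k = 2^{-(k-1)} (1 - γ_k)^{⌊k/2⌋} (1 + γ_k)^{⌊k/2⌋}` (for `k ≥ 1`). -/
noncomputable def alphaStar (k : ℕ) : ℝ :=
  (1 / 2) ^ (k - 1) * (1 - gammaK k) ^ (k / 2) * (1 + gammaK k) ^ (k / 2)

/-! Round each variable independently by its bias: towards its majority sign with probability p if
that sign clearly dominates, by a fair coin otherwise (`roundProb`). The expected fraction O of
satisfied clauses is at most the value (`sum_weight_le_val`). Linear programming duality bounds it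
below: comparing the rounding with an optimal assignment reduces to one inequality per type of
clause, and a `DualCert` solves all of them at once (`clause_bound`, `DualCert.mul_val_le`). With
bias threshold ρ = 1 and p = (a+1)/(2a+1), a = ⌊k/2⌋, the dual solution has value exactly α*_k. For
k ≥ 3 the inequalities that are tight there tolerate a small decrease of ρ, and the value rises
strictly (`exists_dualCert_of_tight`); k = 2 has an explicit certificate.

It remains to estimate O up to a small constant. Sample the variables, store the literal counts of
the sampled ones, and keep the clauses whose variables are all sampled, thinned further by arrival
time. A kept clause has an exactly known weight (`estimate_sketch`). For m clauses of degree at most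
D and sampling probability P, Chebyshev's inequality needs mP^k to be of order D
(`avg_sq_survivors_le`, `card_bad_le`). For m near n this stores about n(D/n)^{1/k} = D^{1/k}
n^{1-1/k} variables. As m is not known in advance, all dyadic scales run in parallel; the sizes of
the variable tables form an essentially geometric series, so this costs only a constant factor
there.

The sampling uses a long random seed. As in Newman's theorem, a short list of seeds serves all
streams (`exists_seeds`), and the index of the seed is kept in memory (`exists_streaming`).

The parameter ε is nearly irrelevant: the value is at least 2^{-k}, so a constant additive error
fits into the gap between α*_k and the certified ratio. -/

namespace MaxAnd

/-! ### Oblivious rounding and weak duality -/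

open Finset

variable {k n : ℕ}

/-- The variables that occur in the clause `C` as literals of sign `b`. -/
def lits (C : Clause k n) (b : Bool) : Finset (Fin n) := if b then C.pos else C.neg

/-- The variables that occur in the clause `C`. -/
def vars (C : Clause k n) : Finset (Fin n) := C.pos ∪ C.neg

/-- The probability that `C` is satisfied when each variable `v` is independently set to true
with probability `P v`. -/
noncomputable def weight (P : Fin n → ℝ) (C : Clause k n) : ℝ :=
  (∏ v ∈ C.pos, P v) * ∏ v ∈ C.neg, (1 - P v)

lemma card_vars (C : Clause k n) : (vars C).card = k := C.card_eq

lemma not_mem_neg (C : Clause k n) (v : Fin n) (h : v ∈ C.pos) : v ∉ C.neg :=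
  Finset.disjoint_left.1 C.disj h

lemma mem_vars_iff (C : Clause k n) (v : Fin n) (b : Bool) :
    v ∈ vars C ↔ v ∈ lits C b ∨ v ∈ lits C (!b) := by
  cases b <;> simp [vars, lits, or_comm]

lemma not_mem_lits_both (C : Clause k n) (v : Fin n) (b : Bool) (h : v ∈ lits C b) :
    v ∉ lits C (!b) := by
  have := not_mem_neg C v
  cases b <;> simp_all [lits]

lemma isSat_iff (C : Clause k n) (x : Fin n → Bool) :
    C.IsSat x ↔ ∀ v ∈ vars C, v ∈ lits C (x v) := by
  have hd := not_mem_neg C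
  constructor
  · rintro ⟨h1, h2⟩ v hv
    rcases Finset.mem_union.1 hv with h | h
    · simp [lits, h1 v h, h]
    · simp [lits, h2 v h, h]
  · intro h
    refine ⟨fun v hv => ?_, fun v hv => ?_⟩
    · have := h v (Finset.mem_union_left _ hv)
      cases hx : x v
      · simp only [hx, lits] at this
        exact absurd this (hd v hv)
      · rfl
    · have := h v (Finset.mem_union_right _ hv)
      cases hx : x v
      · rfl
      · simp only [hx, lits, if_true] at this
        exact absurd hv (hd v this)

lemma weight_eq_prod (P : Fin n → ℝ) (C : Clause k n) (x : Fin n → Bool) :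
    weight P C = ∏ v ∈ vars C,
      (if v ∈ lits C (x v) then (if x v then P v else 1 - P v)
        else 1 - (if x v then P v else 1 - P v)) := by
  have hd := not_mem_neg C
  rw [vars, Finset.prod_union C.disj, weight]
  congr 1
  · refine Finset.prod_congr rfl fun v hv => ?_
    cases hx : x v
    · simp [lits, hd v hv]
    · simp [lits, hv]
  · refine Finset.prod_congr rfl fun v hv => ?_
    have hv' : v ∉ C.pos := fun h => hd v h hv
    cases hx : x v
    · simp [lits, hv]
    · simp [lits, hv']

lemma weight_nonneg {P : Fin n → ℝ} (h0 : ∀ v, 0 ≤ P v) (h1 : ∀ v, P v ≤ 1) (C : Clause k n) :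
    0 ≤ weight P C :=
  mul_nonneg (Finset.prod_nonneg fun v _ => h0 v)
    (Finset.prod_nonneg fun v _ => sub_nonneg.2 (h1 v))

lemma weight_le_one {P : Fin n → ℝ} (h0 : ∀ v, 0 ≤ P v) (h1 : ∀ v, P v ≤ 1) (C : Clause k n) :
    weight P C ≤ 1 := by
  refine mul_le_one₀ (Finset.prod_le_one (fun v _ => h0 v) fun v _ => h1 v)
    (Finset.prod_nonneg fun v _ => sub_nonneg.2 (h1 v))
    (Finset.prod_le_one (fun v _ => sub_nonneg.2 (h1 v)) fun v _ => ?_)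
  linarith [h0 v]

-- Satisfaction is a conjunction of conditions on single coordinates, so the expectation factors
-- over the variables.
open Classical in
lemma sum_prod_mul_isSat (P : Fin n → ℝ) (C : Clause k n) :
    ∑ x : Fin n → Bool, (∏ v, if x v then P v else 1 - P v) * (if C.IsSat x then 1 else 0)
      = weight P C := by
  have hd := not_mem_neg C
  let g : Fin n → Bool → ℝ := fun v b =>
    (if b then P v else 1 - P v) * (if v ∈ vars C → v ∈ lits C b then 1 else 0)
  have h1 : ∀ x : Fin n → Bool,
      (∏ v, if x v then P v else 1 - P v) * (if C.IsSat x then 1 else 0) = ∏ v, g v (x v) := by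
    intro x
    simp only [g, Finset.prod_mul_distrib]
    congr 1
    rw [Finset.prod_ite_zero]
    simp [isSat_iff]
  simp only [h1]
  have h2 : ∑ x : Fin n → Bool, ∏ v, g v (x v) = ∏ v, ∑ b, g v b := by
    rw [Finset.prod_univ_sum, Fintype.piFinset_univ]
  rw [h2, weight]
  have h3 : ∀ v, ∑ b, g v b
      = (if v ∈ C.pos then P v else 1) * (if v ∈ C.neg then 1 - P v else 1) := by
    intro v
    have := hd v
    by_cases hp : v ∈ C.pos <;> by_cases hn : v ∈ C.neg <;> simp_all [g, vars, lits]
  simp only [h3, Finset.prod_mul_distrib, Finset.prod_ite_mem, Finset.univ_inter]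

lemma sum_prod_bernoulli (P : Fin n → ℝ) :
    ∑ x : Fin n → Bool, (∏ v, if x v then P v else 1 - P v) = 1 := by
  have h2 : ∑ x : Fin n → Bool, ∏ v, (fun v (b : Bool) => if b then P v else 1 - P v) v (x v)
      = ∏ v, ∑ b : Bool, (fun v (b : Bool) => if b then P v else 1 - P v) v b := by
    rw [Finset.prod_univ_sum, Fintype.piFinset_univ]
  simpa using h2

lemma countP_eq_sum {α : Type*} (l : List α) (p : α → Bool) :
    ((l.countP p : ℕ) : ℝ) = (l.map fun a => if p a then (1 : ℝ) else 0).sum := by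
  induction l with
  | nil => simp
  | cons a l ih =>
    rw [List.countP_cons, List.map_cons, List.sum_cons, ← ih]
    split_ifs <;> simp [add_comm]

open Classical in
lemma valAt_mul_length (Ψ : Instance k n) (x : Fin n → Bool) (h : Ψ ≠ []) :
    Ψ.valAt x * Ψ.length = (Ψ.map fun C => if C.IsSat x then (1 : ℝ) else 0).sum := by
  have : (Ψ.length : ℝ) ≠ 0 := by simpa using h
  rw [Instance.valAt, div_mul_cancel₀ _ this, countP_eq_sum]
  simp

/-- The expected value of a product distribution is at most the value of the instance. -/
lemma sum_weight_le_val (Ψ : Instance k n) (h : Ψ ≠ []) {P : Fin n → ℝ} (h0 : ∀ v, 0 ≤ P v)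
    (h1 : ∀ v, P v ≤ 1) : (Ψ.map (weight P)).sum ≤ Ψ.val * Ψ.length := by
  classical
  have hs : (Ψ.map (weight P)).sum = ∑ x : Fin n → Bool,
      (∏ v, if x v then P v else 1 - P v) * (Ψ.valAt x * Ψ.length) := by
    simp only [valAt_mul_length Ψ _ h]
    clear h
    induction Ψ with
    | nil => simp
    | cons C Ψ ih =>
      simp only [List.map_cons, List.sum_cons, ih, mul_add, Finset.sum_add_distrib,
        sum_prod_mul_isSat]
  rw [hs]
  calc _ ≤ ∑ x : Fin n → Bool, (∏ v, if x v then P v else 1 - P v) * (Ψ.val * Ψ.length) := by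
        refine Finset.sum_le_sum fun x _ => mul_le_mul_of_nonneg_left
          (mul_le_mul_of_nonneg_right (Finset.le_sup' _ (Finset.mem_univ x)) (Nat.cast_nonneg _))
          (Finset.prod_nonneg fun v _ => ?_)
        split_ifs
        · exact h0 v
        · exact sub_nonneg.2 (h1 v)
    _ = _ := by rw [← Finset.sum_mul, sum_prod_bernoulli, one_mul]

/-- A uniformly random assignment satisfies each clause with probability 2^{-k}. This lower bound
turns additive errors into multiplicative ones. -/
lemma half_pow_le_val (Ψ : Instance k n) (h : Ψ ≠ []) : (1 / 2 : ℝ) ^ k ≤ Ψ.val := by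
  have h1 := sum_weight_le_val Ψ h (P := fun _ => 1 / 2) (fun _ => by norm_num)
    (fun _ => by norm_num)
  have h2 : ∀ C : Clause k n, weight (fun _ => (1 / 2 : ℝ)) C = (1 / 2) ^ k := by
    intro C
    have := card_vars C
    rw [vars, Finset.card_union_of_disjoint C.disj] at this
    rw [weight, Finset.prod_const, Finset.prod_const]
    norm_num
    rw [← pow_add, this]
  have h3 : (Ψ.map (weight fun _ => (1 / 2 : ℝ))).sum = (1 / 2) ^ k * Ψ.length := by
    rw [List.map_congr_left (fun C _ => h2 C), List.map_const', List.sum_replicate, nsmul_eq_mul,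
      mul_comm]
  rw [h3] at h1
  have : (0 : ℝ) < Ψ.length := by
    have := List.length_pos_iff.2 h
    exact_mod_cast this
  exact le_of_mul_le_mul_right h1 this

/-- The number of occurrences of the literal of sign `b` on the variable `v`. -/
def litCount (Ψ : Instance k n) (v : Fin n) (b : Bool) : ℕ :=
  Ψ.countP fun C => v ∈ lits C b

/-- The probability with which a variable with `dp` positive and `dn` negative occurrences is set
to true: `p` if it is clearly biased to true, `1 - p` if clearly biased to false, and `1 / 2`
otherwise. -/
noncomputable def roundProb (p ρ : ℝ) (dp dn : ℕ) : ℝ :=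
  if (dn : ℝ) < ρ * dp then p else if (dp : ℝ) < ρ * dn then 1 - p else 1 / 2

lemma roundProb_nonneg {p ρ : ℝ} (h0 : 0 ≤ p) (h1 : p ≤ 1) (a b : ℕ) :
    0 ≤ roundProb p ρ a b := by
  unfold roundProb
  split_ifs <;> linarith

lemma roundProb_le_one {p ρ : ℝ} (h0 : 0 ≤ p) (h1 : p ≤ 1) (a b : ℕ) :
    roundProb p ρ a b ≤ 1 := by
  unfold roundProb
  split_ifs <;> linarith

/-- The rounding treats the two signs symmetrically, because for ρ ≤ 1 the two biased cases exclude
each other. Hence the optimal assignment may be used as the reference sign. -/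
lemma roundProb_swap {p ρ : ℝ} (h1 : ρ ≤ 1) (a b : ℕ) :
    roundProb p ρ b a = 1 - roundProb p ρ a b := by
  have ha : (0 : ℝ) ≤ a := Nat.cast_nonneg a
  have hb : (0 : ℝ) ≤ b := Nat.cast_nonneg b
  unfold roundProb
  split_ifs with h2 h3
  · nlinarith
  all_goals ring

/-- A feasible solution of the dual of the factor-revealing linear program for the rounding
function `roundProb p ρ`, of value `α`. -/
structure DualCert (k : ℕ) (p ρ lam lam₀ α : ℝ) : Prop where
  p_nonneg : 0 ≤ p
  p_le_one : p ≤ 1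
  rho_nonneg : 0 ≤ ρ
  rho_le_one : ρ ≤ 1
  lam_nonneg : 0 ≤ lam
  lam₀_nonneg : 0 ≤ lam₀
  sat : ∀ i j l, i + j + l = k →
    α - lam * l - lam₀ * ρ * j ≤ p ^ i * (1 / 2) ^ j * (1 - p) ^ l
  unsat : ∀ i j l, i + j + l = k → lam * ρ * i + lam₀ * j ≤ p ^ i * (1 / 2) ^ j * (1 - p) ^ l

-- `R` marks variables biased towards `x`, `W` those biased against it. The extra sum is the
-- Lagrangian term, whose total over all clauses is nonnegative. If `x` satisfies `C`, every literal
-- agrees with `x` and the bound is `sat`. Otherwise a literal contributes at most `lam * ρ`, `lam₀`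
-- or `0`, according to whether it is made true with probability `p`, `1 / 2` or `1 - p`, and the
-- bound is `unsat`.
open Classical in
lemma clause_bound {p ρ lam lam₀ α : ℝ} (h : DualCert k p ρ lam lam₀ α) (C : Clause k n)
    (x : Fin n → Bool) (R W : Fin n → Prop) (hRW : ∀ v, R v → ¬ W v) :
    (α * if C.IsSat x then 1 else 0) + ∑ v,
      (if R v then 0 else if W v then
        lam * (ρ * (if v ∈ lits C (!x v) then 1 else 0) - if v ∈ lits C (x v) then 1 else 0)
      else lam₀ * ((if v ∈ lits C (!x v) then 1 else 0)
        - ρ * if v ∈ lits C (x v) then 1 else 0)) ≤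
    ∏ v ∈ vars C, (if v ∈ lits C (x v) then (if R v then p else if W v then 1 - p else 1 / 2)
        else 1 - (if R v then p else if W v then 1 - p else 1 / 2)) := by
  set cost : Fin n → ℝ := fun v => (if R v then 0 else if W v then
        lam * (ρ * (if v ∈ lits C (!x v) then 1 else 0) - if v ∈ lits C (x v) then 1 else 0)
      else lam₀ * ((if v ∈ lits C (!x v) then 1 else 0)
        - ρ * if v ∈ lits C (x v) then 1 else 0)) with hcost
  -- `I`, `J` and `L` collect the literals that become true with probability `p`, `1 / 2` and `1 -
  -- p`.
  set I := (vars C).filter fun v => (R v ∧ v ∈ lits C (x v)) ∨ (W v ∧ v ∉ lits C (x v)) with hI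
  set V := (vars C).filter fun v => ¬ ((R v ∧ v ∈ lits C (x v)) ∨ (W v ∧ v ∉ lits C (x v)))
    with hV
  set J := V.filter fun v => ¬ R v ∧ ¬ W v with hJ
  set L := V.filter fun v => ¬ (¬ R v ∧ ¬ W v) with hL
  have hcard : I.card + J.card + L.card = k := by
    rw [add_assoc, hJ, hL, Finset.card_filter_add_card_filter_not, hI, hV,
      Finset.card_filter_add_card_filter_not, card_vars]
  have hsplit : ∀ f : Fin n → ℝ, ∑ v ∈ vars C, f v
      = ∑ v ∈ I, f v + (∑ v ∈ J, f v + ∑ v ∈ L, f v) := by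
    intro f
    rw [hJ, hL, Finset.sum_filter_add_sum_filter_not, hI, hV,
      Finset.sum_filter_add_sum_filter_not]
  have hprod : ∏ v ∈ vars C,
      (if v ∈ lits C (x v) then (if R v then p else if W v then 1 - p else 1 / 2)
        else 1 - (if R v then p else if W v then 1 - p else 1 / 2))
      = p ^ I.card * (1 / 2) ^ J.card * (1 - p) ^ L.card := by
    rw [← Finset.prod_filter_mul_prod_filter_not (vars C)
      fun v => (R v ∧ v ∈ lits C (x v)) ∨ (W v ∧ v ∉ lits C (x v)), ← hI, ← hV,
      ← Finset.prod_filter_mul_prod_filter_not V fun v => ¬ R v ∧ ¬ W v, ← hJ, ← hL, mul_assoc]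
    have hIp : ∀ v ∈ I, (if v ∈ lits C (x v) then
        (if R v then p else if W v then 1 - p else 1 / 2)
        else 1 - (if R v then p else if W v then 1 - p else 1 / 2)) = p := by
      intro v hv
      rcases (Finset.mem_filter.1 hv).2 with ⟨h1, h2⟩ | ⟨h1, h2⟩
      · simp [h1, h2]
      · have hr : ¬ R v := fun hr => hRW v hr h1
        simp [h1, h2, hr]
    have hJp : ∀ v ∈ J, (if v ∈ lits C (x v) then
        (if R v then p else if W v then 1 - p else 1 / 2)
        else 1 - (if R v then p else if W v then 1 - p else 1 / 2)) = 1 / 2 := by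
      intro v hv
      have := (Finset.mem_filter.1 hv).2
      simp only [this.1, this.2, if_false]
      split_ifs <;> norm_num
    have hLp : ∀ v ∈ L, (if v ∈ lits C (x v) then
        (if R v then p else if W v then 1 - p else 1 / 2)
        else 1 - (if R v then p else if W v then 1 - p else 1 / 2)) = 1 - p := by
      intro v hv
      have h1 := (Finset.mem_filter.1 hv).2
      have h2 := (Finset.mem_filter.1 (Finset.mem_filter.1 hv).1).2
      have h3 := hRW v
      by_cases hr : R v <;> by_cases hw : W v <;> by_cases hl : v ∈ lits C (x v) <;>
        simp_all
    rw [Finset.prod_congr rfl hIp, Finset.prod_congr rfl hJp, Finset.prod_congr rfl hLp]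
    simp
  have hout : ∑ v, cost v = ∑ v ∈ vars C, cost v := by
    symm
    refine Finset.sum_subset (Finset.subset_univ _) fun v _ hv => ?_
    rw [mem_vars_iff C v (x v), not_or] at hv
    simp [hcost, hv.1, hv.2]
  rw [hout, hprod]
  by_cases hs : C.IsSat x
  · have hall := (isSat_iff C x).1 hs
    have hcI : ∀ v ∈ I, cost v = 0 := by
      intro v hv
      have h1 := hall v (Finset.mem_filter.1 hv).1
      have h2 := (Finset.mem_filter.1 hv).2
      have : R v := by tauto
      simp [hcost, this]
    have hcJ : ∀ v ∈ J, cost v = - (lam₀ * ρ) := by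
      intro v hv
      have h1 := hall v (Finset.mem_filter.1 (Finset.mem_filter.1 hv).1).1
      have h2 := (Finset.mem_filter.1 hv).2
      simp [hcost, h2.1, h2.2, h1, not_mem_lits_both C v _ h1]
    have hcL : ∀ v ∈ L, cost v = - lam := by
      intro v hv
      have h1 := hall v (Finset.mem_filter.1 (Finset.mem_filter.1 hv).1).1
      have h2 := (Finset.mem_filter.1 hv).2
      have h3 := (Finset.mem_filter.1 (Finset.mem_filter.1 hv).1).2
      have hr : ¬ R v := by tauto
      have hw : W v := by tauto
      simp [hcost, hr, hw, h1, not_mem_lits_both C v _ h1]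
    rw [hsplit, Finset.sum_congr rfl hcI, Finset.sum_congr rfl hcJ, Finset.sum_congr rfl hcL]
    have := h.sat _ _ _ hcard
    simp only [hs, if_true, Finset.sum_const, nsmul_eq_mul]
    linarith
  · have hlr : 0 ≤ lam * ρ := mul_nonneg h.lam_nonneg h.rho_nonneg
    have hlr0 : 0 ≤ lam₀ * ρ := mul_nonneg h.lam₀_nonneg h.rho_nonneg
    have hl0 := h.lam₀_nonneg
    have hl := h.lam_nonneg
    have hcI : ∀ v ∈ I, cost v ≤ lam * ρ := by
      intro v hv
      rcases (Finset.mem_filter.1 hv).2 with ⟨h1, h2⟩ | ⟨h1, h2⟩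
      · simp [hcost, h1, hlr]
      · simp only [hcost, h1, h2, if_neg (fun hr => hRW v hr h1), if_true, if_false]
        split_ifs <;> nlinarith
    have hcJ : ∀ v ∈ J, cost v ≤ lam₀ := by
      intro v hv
      have h2 := (Finset.mem_filter.1 hv).2
      simp only [hcost, h2.1, h2.2, if_false]
      split_ifs <;> nlinarith
    have hcL : ∀ v ∈ L, cost v ≤ 0 := by
      intro v hv
      have h0 := (Finset.mem_filter.1 (Finset.mem_filter.1 hv).1).1
      have h2 := (Finset.mem_filter.1 hv).2
      have h3 := (Finset.mem_filter.1 (Finset.mem_filter.1 hv).1).2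
      by_cases hr : R v
      · simp [hcost, hr]
      · have hw : W v := by tauto
        have h1 : v ∈ lits C (x v) := by tauto
        simp [hcost, hr, hw, h1, not_mem_lits_both C v _ h1, hl]
    rw [hsplit]
    have e1 := Finset.sum_le_sum hcI
    have e2 := Finset.sum_le_sum hcJ
    have e3 := Finset.sum_le_sum hcL
    have := h.unsat _ _ _ hcard
    simp only [hs, if_false, Finset.sum_const, nsmul_eq_mul] at *
    linarith

lemma sum_map_sub {α : Type*} (l : List α) (f g : α → ℝ) :
    (l.map fun a => f a - g a).sum = (l.map f).sum - (l.map g).sum := by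
  induction l with
  | nil => simp
  | cons a l ih => simp [ih]; ring

lemma sum_map_sum_comm {α ι : Type*} [Fintype ι] (l : List α) (f : α → ι → ℝ) :
    (l.map fun a => ∑ i, f a i).sum = ∑ i, (l.map fun a => f a i).sum := by
  induction l with
  | nil => simp
  | cons a l ih => simp [ih, Finset.sum_add_distrib]

/-- Weak duality: the oblivious algorithm given by `roundProb p ρ` is an `α`-approximation. -/
theorem DualCert.mul_val_le {p ρ lam lam₀ α : ℝ} (h : DualCert k p ρ lam lam₀ α)
    (Ψ : Instance k n) (hΨ : Ψ ≠ []) :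
    α * (Ψ.val * Ψ.length) ≤
      (Ψ.map (weight fun v => roundProb p ρ (litCount Ψ v true) (litCount Ψ v false))).sum := by
  classical
  obtain ⟨x, -, hx⟩ := Finset.exists_mem_eq_sup' (Finset.univ_nonempty (α := Fin n → Bool))
    fun x => Ψ.valAt x
  rw [Instance.val, hx, valAt_mul_length Ψ x hΨ]
  set A : Fin n → ℕ := fun v => litCount Ψ v (x v) with hA
  set B : Fin n → ℕ := fun v => litCount Ψ v (!x v) with hB
  set R : Fin n → Prop := fun v => (B v : ℝ) < ρ * A v with hR
  set W : Fin n → Prop := fun v => (A v : ℝ) < ρ * B v with hW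
  have hRW : ∀ v, R v → ¬ W v := by
    intro v h1 h2
    have ha : (0 : ℝ) ≤ A v := Nat.cast_nonneg _
    have hb : (0 : ℝ) ≤ B v := Nat.cast_nonneg _
    have := h.rho_le_one
    have := h.rho_nonneg
    simp only [hR, hW] at h1 h2
    nlinarith
  have hP : ∀ v, (if x v then roundProb p ρ (litCount Ψ v true) (litCount Ψ v false)
      else 1 - roundProb p ρ (litCount Ψ v true) (litCount Ψ v false))
      = if R v then p else if W v then 1 - p else 1 / 2 := by
    intro v
    cases hv : x v
    · simp only [Bool.false_eq_true, if_false]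
      rw [← roundProb_swap h.rho_le_one]
      simp [roundProb, hR, hW, hA, hB, hv]
    · simp [roundProb, hR, hW, hA, hB, hv]
  have hcl : ∀ C : Clause k n,
      weight (fun v => roundProb p ρ (litCount Ψ v true) (litCount Ψ v false)) C
      = ∏ v ∈ vars C, (if v ∈ lits C (x v) then (if R v then p else if W v then 1 - p else 1 / 2)
        else 1 - (if R v then p else if W v then 1 - p else 1 / 2)) := by
    intro C
    rw [weight_eq_prod _ C x]
    simp only [hP]
  rw [List.map_congr_left fun C _ => hcl C]
  refine le_trans ?_ (List.sum_le_sum fun C _ => clause_bound h C x R W hRW)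
  have hcount : ∀ v b, (litCount Ψ v b : ℝ)
      = (Ψ.map fun C => if v ∈ lits C b then (1 : ℝ) else 0).sum := by
    intro v b
    rw [litCount, countP_eq_sum]
    simp
  rw [List.sum_map_add, List.sum_map_mul_left, sum_map_sum_comm, le_add_iff_nonneg_right]
  refine Finset.sum_nonneg fun v _ => ?_
  -- Summed over the clauses, the charges of `v` become `lam * (ρ * B v - A v)` or `lam₀ * (B v - ρ
  -- * A v)`; both are nonnegative by the definition of the case.
  by_cases hr : R v
  · simp [hr]
  by_cases hw : W v
  · simp only [hr, hw, if_true, if_false]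
    rw [List.sum_map_mul_left, sum_map_sub, List.sum_map_mul_left, ← hcount, ← hcount]
    exact mul_nonneg h.lam_nonneg (sub_nonneg.2 hw.le)
  · simp only [hr, hw, if_false]
    rw [List.sum_map_mul_left, sum_map_sub, List.sum_map_mul_left, ← hcount, ← hcount]
    exact mul_nonneg h.lam₀_nonneg (sub_nonneg.2 (not_lt.1 hr))

end MaxAnd

/-! ### Certificates that beat α*_k -/

namespace MaxAnd

open Finset

-- Perturbation of the certificate with ρ = 1 and value Λk. With ρ = 1/(1+τ) the choices below turn
-- `unsat` into exactly `hweak`, while the `sat` bound changes to first order by Λτ(1/2 - l + j/2).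
-- This is nonpositive when j + 1 ≤ 2l; in the other cases strictness absorbs it for small τ. The
-- value increases by Λτ/2.
open Filter Topology in
lemma exists_dualCert_of_tight {k : ℕ} {p Λ : ℝ} (hΛ : 0 < Λ) (hp0 : 0 ≤ p) (hp1 : p ≤ 1)
    (hweak : ∀ i j l, i + j + l = k → Λ * (i + j / 2) ≤ p ^ i * (1 / 2) ^ j * (1 - p) ^ l)
    (hstrict : ∀ i j l, i + j + l = k →
      j + 1 ≤ 2 * l ∨ Λ * (i + j / 2) < p ^ i * (1 / 2) ^ j * (1 - p) ^ l) :
    ∃ ρ lam lam₀ α, DualCert k p ρ lam lam₀ α ∧ Λ * k < α := by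
  have hev : ∀ᶠ τ : ℝ in 𝓝[>] 0, ∀ i ∈ range (k + 1), ∀ j ∈ range (k + 1), ∀ l ∈ range (k + 1),
      i + j + l = k →
      Λ * (i + j / 2 + τ * (1 / 2 - l + j / 2)) ≤ p ^ i * (1 / 2) ^ j * (1 - p) ^ l := by
    simp only [Filter.eventually_all_finset]
    intro i _ j _ l _
    by_cases hk : i + j + l = k
    · simp only [hk, forall_const]
      rcases hstrict i j l hk with h | h
      · have h' : (j : ℝ) + 1 ≤ 2 * l := by exact_mod_cast h
        filter_upwards [self_mem_nhdsWithin] with τ hτ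
        have hτ' : (0 : ℝ) < τ := hτ
        refine le_trans (mul_le_mul_of_nonneg_left ?_ hΛ.le) (hweak i j l hk)
        nlinarith
      · have hc : Continuous fun τ : ℝ => Λ * ((i : ℝ) + j / 2 + τ * (1 / 2 - l + j / 2)) := by
          fun_prop
        have ht := hc.tendsto 0
        simp only [zero_mul, add_zero] at ht
        filter_upwards [nhdsWithin_le_nhds (ht.eventually_lt_const h)] with τ hτ using hτ.le
    · simp [hk]
  obtain ⟨τ, hτ, hτ0⟩ := (hev.and self_mem_nhdsWithin).exists
  have hτ0 : 0 < τ := hτ0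
  have hρ : (1 + τ)⁻¹ ≤ 1 := inv_le_one_of_one_le₀ (by linarith)
  -- This linear lower bound for ρ suffices because ρ enters `sat` only through the subtracted term
  -- `lam₀ * ρ * j`.
  have hρ' : 1 - τ ≤ (1 + τ)⁻¹ := by
    rw [← one_div, le_div_iff₀ (by linarith)]
    nlinarith
  refine ⟨(1 + τ)⁻¹, Λ * (1 + τ), Λ / 2, Λ * k + Λ * τ / 2, ⟨hp0, hp1, by positivity, hρ,
    by positivity, by positivity, ?_, ?_⟩, by have := mul_pos hΛ hτ0; linarith⟩
  · intro i j l h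
    refine le_trans ?_ (hτ i (by simp; omega) j (by simp; omega) l (by simp; omega) h)
    have hk : (k : ℝ) = i + j + l := by exact_mod_cast h.symm
    have : Λ / 2 * (1 - τ) * j ≤ Λ / 2 * (1 + τ)⁻¹ * j := by gcongr
    rw [hk]
    nlinarith
  · intro i j l h
    refine le_trans (le_of_eq ?_) (hweak i j l h)
    have : 1 + τ ≠ 0 := by positivity
    field_simp

section

variable {a k : ℕ} {p q : ℝ}

/-- Since p/q = (a+1)/a, one has (t+1)q ≤ tp for t ≥ a and the reverse for t ≤ a, with equality only
at t = a. So p^i q^{k-i}/i decreases up to i = a, is equal at a and a+1, and increases afterwards.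
This lemma and the next three iterate the one-step comparison away from a. -/
lemma mul_pow_le_up (ha : 0 < a) (hq : 0 < q) (hpq : a * p = (a + 1) * q) (m : ℕ) :
    (a + m) * q ^ m ≤ a * p ^ m := by
  have ha' : (0 : ℝ) < a := by exact_mod_cast ha
  have hp : p = (a + 1) * q / a := by field_simp; linarith
  induction m with
  | zero => simp
  | succ m ih =>
    have hp0 : 0 < p := by rw [hp]; positivity
    have h1 : (a + m + 1) * q ≤ (a + m) * p := by
      rw [hp, mul_div_assoc', le_div_iff₀ ha']
      have : (0 : ℝ) ≤ m * q := by positivity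
      nlinarith
    calc ((a : ℝ) + (m + 1 : ℕ)) * q ^ (m + 1) = (a + m + 1) * q * q ^ m := by push_cast; ring
      _ ≤ (a + m) * p * q ^ m := by gcongr
      _ = p * ((a + m) * q ^ m) := by ring
      _ ≤ p * (a * p ^ m) := by gcongr
      _ = a * p ^ (m + 1) := by ring

lemma mul_pow_lt_up (ha : 0 < a) (hq : 0 < q) (hpq : a * p = (a + 1) * q) {m : ℕ} (hm : 2 ≤ m) :
    (a + m) * q ^ m < a * p ^ m := by
  have ha' : (0 : ℝ) < a := by exact_mod_cast ha
  have hp : p = (a + 1) * q / a := by field_simp; linarith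
  have hp0 : 0 < p := by rw [hp]; positivity
  obtain ⟨m, rfl⟩ : ∃ m', m = m' + 1 := ⟨m - 1, by omega⟩
  have hm' : (1 : ℝ) ≤ m := by exact_mod_cast (by omega : 1 ≤ m)
  have h1 : (a + m + 1) * q < (a + m) * p := by
    rw [hp, mul_div_assoc', lt_div_iff₀ ha']
    have : (0 : ℝ) < m * q := by positivity
    nlinarith
  calc ((a : ℝ) + (m + 1 : ℕ)) * q ^ (m + 1) = (a + m + 1) * q * q ^ m := by push_cast; ring
    _ < (a + m) * p * q ^ m := by gcongr
    _ = p * ((a + m) * q ^ m) := by ring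
    _ ≤ p * (a * p ^ m) := mul_le_mul_of_nonneg_left (mul_pow_le_up ha hq hpq m) hp0.le
    _ = a * p ^ (m + 1) := by ring

lemma mul_pow_le_down (ha : 0 < a) (hq : 0 < q) (hpq : a * p = (a + 1) * q) (m i : ℕ)
    (h : i + m ≤ a) : i * p ^ m ≤ (i + m) * q ^ m := by
  have ha' : (0 : ℝ) < a := by exact_mod_cast ha
  have hp : p = (a + 1) * q / a := by field_simp; linarith
  have hp0 : 0 < p := by rw [hp]; positivity
  induction m generalizing i with
  | zero => simp
  | succ m ih =>
    have hi : (i : ℝ) ≤ a := by exact_mod_cast (by omega : i ≤ a)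
    have h1 : i * p ≤ (i + 1) * q := by
      rw [hp, mul_div_assoc', div_le_iff₀ ha']
      nlinarith
    have := ih (i + 1) (by omega)
    push_cast at this ⊢
    calc (i : ℝ) * p ^ (m + 1) = i * p * p ^ m := by ring
      _ ≤ (i + 1) * q * p ^ m := by gcongr
      _ = q * ((i + 1) * p ^ m) := by ring
      _ ≤ q * ((i + 1 + m) * q ^ m) := by gcongr
      _ = _ := by ring

lemma mul_pow_lt_down (ha : 0 < a) (hq : 0 < q) (hpq : a * p = (a + 1) * q) {m i : ℕ}
    (h : i + m ≤ a) (hm : 1 ≤ m) : i * p ^ m < (i + m) * q ^ m := by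
  have ha' : (0 : ℝ) < a := by exact_mod_cast ha
  have hp : p = (a + 1) * q / a := by field_simp; linarith
  have hp0 : 0 < p := by rw [hp]; positivity
  obtain ⟨m, rfl⟩ : ∃ m', m = m' + 1 := ⟨m - 1, by omega⟩
  have hi : (i : ℝ) < a := by exact_mod_cast (by omega : i < a)
  have h1 : i * p < (i + 1) * q := by
    rw [hp, mul_div_assoc', div_lt_iff₀ ha']
    nlinarith
  have := mul_pow_le_down ha hq hpq m (i + 1) (by omega)
  push_cast at this ⊢
  calc (i : ℝ) * p ^ (m + 1) = i * p * p ^ m := by ring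
    _ < (i + 1) * q * p ^ m := by gcongr
    _ = q * ((i + 1) * p ^ m) := by ring
    _ ≤ q * ((i + 1 + m) * q ^ m) := by gcongr
    _ = _ := by ring

/-- The ratio p^i q^{k-i}/i is least at i = a; the two cases are the two monotone branches,
multiplied by the common powers of p and q. -/
lemma ratio_le (ha : 0 < a) (hak : a ≤ k) (hq : 0 < q) (hpq : a * p = (a + 1) * q) {i l : ℕ}
    (h : i + l = k) : p ^ a * q ^ (k - a) / a * i ≤ p ^ i * q ^ l := by
  have ha' : (0 : ℝ) < a := by exact_mod_cast ha
  have hp : p = (a + 1) * q / a := by field_simp; linarith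
  have hp0 : 0 < p := by rw [hp]; positivity
  rw [div_mul_eq_mul_div, div_le_iff₀ ha']
  rcases le_total a i with hi | hi
  · obtain ⟨m, rfl⟩ := Nat.exists_eq_add_of_le hi
    rw [show k - a = l + m by omega, pow_add, pow_add]
    have := mul_pow_le_up ha hq hpq m
    push_cast
    calc _ = p ^ a * q ^ l * ((a + m) * q ^ m) := by ring
      _ ≤ p ^ a * q ^ l * (a * p ^ m) := by gcongr
      _ = _ := by ring
  · obtain ⟨m, rfl⟩ := Nat.exists_eq_add_of_le hi
    have := mul_pow_le_down ha hq hpq m i le_rfl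
    rw [show l = (k - (i + m)) + m by omega, pow_add, pow_add]
    push_cast
    calc _ = p ^ i * q ^ (k - (i + m)) * (i * p ^ m) := by ring
      _ ≤ p ^ i * q ^ (k - (i + m)) * ((i + m) * q ^ m) := by gcongr
      _ = _ := by ring

lemma ratio_lt (ha : 0 < a) (hak : a ≤ k) (hq : 0 < q) (hpq : a * p = (a + 1) * q) {i l : ℕ}
    (h : i + l = k) (h0 : i ≠ a) (h1 : i ≠ a + 1) :
    p ^ a * q ^ (k - a) / a * i < p ^ i * q ^ l := by
  have ha' : (0 : ℝ) < a := by exact_mod_cast ha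
  have hp : p = (a + 1) * q / a := by field_simp; linarith
  have hp0 : 0 < p := by rw [hp]; positivity
  rw [div_mul_eq_mul_div, div_lt_iff₀ ha']
  rcases le_total a i with hi | hi
  · obtain ⟨m, rfl⟩ := Nat.exists_eq_add_of_le hi
    rw [show k - a = l + m by omega, pow_add, pow_add]
    have := mul_pow_lt_up ha hq hpq (m := m) (by omega)
    push_cast
    calc _ = p ^ a * q ^ l * ((a + m) * q ^ m) := by ring
      _ < p ^ a * q ^ l * (a * p ^ m) := by gcongr
      _ = _ := by ring
  · obtain ⟨m, rfl⟩ := Nat.exists_eq_add_of_le hi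
    have := mul_pow_lt_down ha hq hpq (m := m) (i := i) le_rfl (by omega)
    rw [show l = (k - (i + m)) + m by omega, pow_add, pow_add]
    push_cast
    calc _ = p ^ i * q ^ (k - (i + m)) * (i * p ^ m) := by ring
      _ < p ^ i * q ^ (k - (i + m)) * ((i + m) * q ^ m) := by gcongr
      _ = _ := by ring

variable {Λ : ℝ}

/-- A fair coin is the average of a `p`-coin and a `(1 - p)`-coin. As i + j/2 averages in the same
way, inequalities with j > 0 follow from those with j = 0. -/
lemma half_step (i j l : ℕ) : p ^ i * (1 / 2) ^ (j + 1) * (1 - p) ^ l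
    = (p ^ (i + 1) * (1 / 2) ^ j * (1 - p) ^ l + p ^ i * (1 / 2) ^ j * (1 - p) ^ (l + 1)) / 2 := by
  ring

lemma weak_of_base (hb : ∀ i l, i + l = k → Λ * i ≤ p ^ i * (1 - p) ^ l) (j i l : ℕ)
    (h : i + j + l = k) : Λ * (i + j / 2) ≤ p ^ i * (1 / 2) ^ j * (1 - p) ^ l := by
  induction j generalizing i l with
  | zero => simpa using hb i l (by omega)
  | succ j ih =>
    have h1 := ih (i + 1) l (by omega)
    have h2 := ih i (l + 1) (by omega)
    rw [half_step]
    push_cast at *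
    linarith

/-- An average of weak inequalities is strict once one of them is. With tight base points i = a and
i = a + 1, the only averages left out are these points and their midpoint i = a, j = 1. -/
lemma strict_of_base (hb : ∀ i l, i + l = k → Λ * i ≤ p ^ i * (1 - p) ^ l)
    (hs : ∀ i l, i + l = k → i ≠ a → i ≠ a + 1 → Λ * i < p ^ i * (1 - p) ^ l) (j i l : ℕ)
    (h : i + j + l = k) (h0 : j = 0 → i ≠ a ∧ i ≠ a + 1) (h1 : j = 1 → i ≠ a) :
    Λ * (i + j / 2) < p ^ i * (1 / 2) ^ j * (1 - p) ^ l := by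
  induction j generalizing i l with
  | zero => simpa using hs i l (by omega) (h0 rfl).1 (h0 rfl).2
  | succ j ih =>
    have e1 := weak_of_base hb j (i + 1) l (by omega)
    have e2 := weak_of_base hb j i (l + 1) (by omega)
    have h3 : (i ≠ a ∧ (j = 0 → i ≠ a + 1)) ∨ (i = a ∧ 1 ≤ j) ∨ (j = 0 ∧ i = a + 1) := by
      have : j = 0 → i ≠ a := fun h => h1 (by omega)
      rcases Nat.eq_zero_or_pos j with hj | hj
      · have := this hj; tauto
      · have : j ≠ 0 := by omega
        by_cases i = a <;> tauto
    rw [half_step]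
    rcases h3 with ⟨h3, h4⟩ | ⟨h3, h4⟩ | ⟨h3, h4⟩
    · have := ih i (l + 1) (by omega) (fun h => ⟨h3, h4 h⟩) fun _ => h3
      push_cast at *
      linarith
    · have := ih (i + 1) l (by omega) (fun h => by omega) fun _ => by omega
      push_cast at *
      linarith
    · have := ih (i + 1) l (by omega) (fun _ => by omega) fun _ => by omega
      push_cast at *
      linarith

end

lemma gammaK_eq {k : ℕ} (hk : 2 ≤ k) : gammaK k = 1 / (2 * ((k / 2 : ℕ) : ℝ) + 1) := by
  unfold gammaK
  split_ifs with h
  · obtain ⟨m, rfl⟩ := h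
    rw [show (2 * m + 1) / 2 = m by omega]
    push_cast
    rfl
  · obtain ⟨m, rfl⟩ := Nat.not_odd_iff_even.1 h
    rw [show (m + m) / 2 = m by omega]
    push_cast
    ring

/-- For every `k ≥ 2` some oblivious algorithm is better than `alphaStar k`. -/
theorem exists_dualCert {k : ℕ} (hk : 2 ≤ k) :
    ∃ p ρ lam lam₀ α, DualCert k p ρ lam lam₀ α ∧ alphaStar k < α := by
  rcases hk.eq_or_lt with rfl | hk3
  -- The perturbation fails for k = 2, since the tight point i = 2 has l = 0. Here `lam * ρ = p * (1
  -- - p)` and `lam₀ = p / 2 - p * (1 - p)` make two `unsat` constraints tight, and 0.449 exceeds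
  -- α*_2 = 4/9.
  · refine ⟨0.675, 0.95, 0.219375 / 0.95, 0.118125, 0.449,
      ⟨by norm_num, by norm_num, by norm_num, by norm_num, by norm_num, by norm_num, ?_, ?_⟩, ?_⟩
    · intro i j l h
      have hi : i ≤ 2 := by omega
      have hj : j ≤ 2 := by omega
      obtain rfl : l = 2 - i - j := by omega
      interval_cases i <;> interval_cases j <;> first | omega | norm_num
    · intro i j l h
      have hi : i ≤ 2 := by omega
      have hj : j ≤ 2 := by omega
      obtain rfl : l = 2 - i - j := by omega
      interval_cases i <;> interval_cases j <;> first | omega | norm_num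
    · rw [alphaStar, gammaK_eq le_rfl]
      norm_num
  · set a := k / 2 with ha
    have ha0 : 0 < a := by omega
    have ha' : (0 : ℝ) < a := by exact_mod_cast ha0
    have hak : a ≤ k := by omega
    set p : ℝ := (a + 1) / (2 * a + 1) with hp
    have hq : 1 - p = a / (2 * a + 1) := by rw [hp]; field_simp; ring
    have hq0 : 0 < 1 - p := by rw [hq]; positivity
    have hp0 : 0 < p := by rw [hp]; positivity
    have hpq : a * p = (a + 1) * (1 - p) := by rw [hq, hp]; ring
    set Λ : ℝ := p ^ a * (1 - p) ^ (k - a) / a with hΛ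
    have hb : ∀ i l, i + l = k → Λ * i ≤ p ^ i * (1 - p) ^ l := fun i l h =>
      ratio_le ha0 hak hq0 hpq h
    have hs : ∀ i l, i + l = k → i ≠ a → i ≠ a + 1 → Λ * i < p ^ i * (1 - p) ^ l :=
      fun i l h h0 h1 => ratio_lt ha0 hak hq0 hpq h h0 h1
    obtain ⟨ρ, lam, lam₀, α, hc, hα⟩ := exists_dualCert_of_tight (k := k) (p := p) (Λ := Λ)
      (by rw [hΛ]; positivity) hp0.le (by linarith) (fun i j l h => weak_of_base hb j i l h)
      -- The possibly tight triples have i = a, j ≤ 1 or i = a + 1, j = 0. As k ≥ 3, each has l ≥ 1,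
      -- so j + 1 ≤ 2l.
      (by
        intro i j l h
        by_cases hl : j + 1 ≤ 2 * l
        · exact Or.inl hl
        · exact Or.inr (strict_of_base hb hs j i l h (fun _ => by omega) fun _ => by omega))
    refine ⟨p, ρ, lam, lam₀, α, hc, lt_of_eq_of_lt ?_ hα⟩
    -- Here 1 + γ_k = 2p and 1 - γ_k = 2(1 - p), which gives α*_k = Λk.
    have h4 : (1 - gammaK k) ^ a * (1 + gammaK k) ^ a = 4 ^ a * (p ^ a * (1 - p) ^ a) := by
      rw [← mul_pow, ← mul_pow, ← mul_pow, gammaK_eq hk, ← ha, hq, hp]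
      congr 1
      field_simp
      ring
    rw [alphaStar, ← ha, mul_assoc, h4, hΛ]
    rcases Nat.even_or_odd' k with ⟨b, hb | hb⟩
    · obtain rfl : a = b := by omega
      rw [show k - a = a by omega, show (4 : ℝ) = 2 ^ 2 by norm_num, ← pow_mul,
        show 2 * a = (k - 1) + 1 by omega, pow_succ, one_div, inv_pow]
      have : (k : ℝ) = 2 * a := by exact_mod_cast hb
      rw [this]
      field_simp
    · obtain rfl : a = b := by omega
      rw [show k - a = a + 1 by omega, show (4 : ℝ) = 2 ^ 2 by norm_num, ← pow_mul,
        show 2 * a = (k - 1) by omega, one_div, inv_pow, pow_succ]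
      have : (k : ℝ) = 2 * a + 1 := by exact_mod_cast hb
      rw [this]
      nth_rw 3 [hq]
      field_simp

end MaxAnd

/-! ### Reducing the seed, and compiling sketches into streaming algorithms -/

namespace MaxAnd

open Finset

open Classical in
/-- A randomized computation which fails on each of at most `2 ^ N` inputs with probability at most
`1 / 1000` still fails with probability at most `1 / 100` when its random seed is drawn from a
suitable list of `500 * (N + 1)` seeds. -/
theorem exists_seeds {Ω I : Type*} [Fintype Ω] [Nonempty Ω] (V : Finset I) (bad : I → Ω → Prop)
    (hbad : ∀ i ∈ V, 1000 * #{ω | bad i ω} ≤ Fintype.card Ω) (N : ℕ) (hV : #V ≤ 2 ^ N) :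
    ∃ g : Fin (500 * (N + 1)) → Ω, ∀ i ∈ V, 100 * #{s | bad i (g s)} ≤ 500 * (N + 1) := by
  by_contra! hcon
  set T := 500 * (N + 1) with hT
  have hΩ : (0 : ℝ) < Fintype.card Ω := by exact_mod_cast Fintype.card_pos
  -- Exponential moment method: a list `g` that fails on some input has more than T/100 = 5(N+1) bad
  -- seeds there, so 2 to the number of bad seeds is large. For random `g` the mean of this quantity
  -- is at most 1.001^T ≤ 2^{N+1} per input, and 2^N · 2^{N+1} < 2^{5(N+1)}.
  have hlow : ∀ g : Fin T → Ω, (2 : ℝ) ^ (5 * (N + 1)) ≤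
      ∑ i ∈ V, ∏ s, (if bad i (g s) then (2 : ℝ) else 1) := by
    intro g
    obtain ⟨i, hi, h⟩ := hcon g
    have hnn : ∀ j ∈ V, (0 : ℝ) ≤ ∏ s, (if bad j (g s) then (2 : ℝ) else 1) := fun j _ =>
      Finset.prod_nonneg fun s _ => by split_ifs <;> norm_num
    refine le_trans ?_ (Finset.single_le_sum hnn hi)
    rw [Finset.prod_ite]
    simp only [Finset.prod_const, one_pow, mul_one]
    exact pow_le_pow_right₀ (by norm_num) (by omega)
  have hup : ∀ i ∈ V, ∑ g : Fin T → Ω, ∏ s, (if bad i (g s) then (2 : ℝ) else 1)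
      ≤ (Fintype.card Ω : ℝ) ^ T * 2 ^ (N + 1) := by
    intro i hi
    have h1 : ∑ g : Fin T → Ω, ∏ s, (if bad i (g s) then (2 : ℝ) else 1)
        = (∑ ω : Ω, if bad i ω then (2 : ℝ) else 1) ^ T := by
      have := (Finset.prod_univ_sum (fun _ : Fin T => (Finset.univ : Finset Ω))
        (fun _ ω => if bad i ω then (2 : ℝ) else 1)).symm
      simpa [Fintype.piFinset_univ] using this
    have h2 : (∑ ω : Ω, if bad i ω then (2 : ℝ) else 1) ≤ Fintype.card Ω * (1001 / 1000) := by
      have h3 : ∀ ω, (if bad i ω then (2 : ℝ) else 1) = 1 + if bad i ω then 1 else 0 := by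
        intro ω; split_ifs <;> norm_num
      have h4 : (1000 : ℝ) * #{ω | bad i ω} ≤ Fintype.card Ω := by exact_mod_cast hbad i hi
      simp only [h3, Finset.sum_add_distrib, Finset.sum_boole, Finset.sum_const, nsmul_eq_mul,
        Finset.card_univ, mul_one]
      linarith
    rw [h1]
    calc _ ≤ ((Fintype.card Ω : ℝ) * (1001 / 1000)) ^ T := by
          refine pow_le_pow_left₀ (Finset.sum_nonneg fun ω _ => ?_) h2 T
          split_ifs <;> norm_num
      _ = (Fintype.card Ω : ℝ) ^ T * ((1001 / 1000) ^ 500) ^ (N + 1) := by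
          rw [mul_pow, hT, ← pow_mul (1001 / 1000 : ℝ)]
      _ ≤ _ := by
          gcongr
          calc ((1001 / 1000 : ℝ)) ^ 500 = ((1001 / 1000) ^ 250) ^ 2 := by rw [← pow_mul]
            _ ≤ (13 / 10) ^ 2 := by gcongr; norm_num
            _ ≤ 2 := by norm_num
  have h := Finset.sum_le_sum fun g (_ : g ∈ (Finset.univ : Finset (Fin T → Ω))) => hlow g
  rw [Finset.sum_comm] at h
  have h' := h.trans (Finset.sum_le_sum hup)
  simp only [Finset.sum_const, nsmul_eq_mul, Finset.card_univ, Fintype.card_pi, Finset.prod_const,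
    Fintype.card_fin, Nat.cast_pow] at h'
  have hVr : (#V : ℝ) ≤ 2 ^ N := by exact_mod_cast hV
  have hpos : (0 : ℝ) < (Fintype.card Ω : ℝ) ^ T := by positivity
  have h5 : (Fintype.card Ω : ℝ) ^ T * 2 ^ (5 * (N + 1))
      ≤ (Fintype.card Ω : ℝ) ^ T * 2 ^ (N + (N + 1)) := by
    calc _ ≤ _ := h'
      _ ≤ 2 ^ N * ((Fintype.card Ω : ℝ) ^ T * 2 ^ (N + 1)) := by gcongr
      _ = _ := by ring
  have h6 := le_of_mul_le_mul_left h5 hpos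
  rw [pow_le_pow_iff_right₀ (by norm_num)] at h6
  omega

open Classical in
lemma toMeasure_map_uniform {T : ℕ} [NeZero T] (f : Fin T → ℝ) {S : Set ℝ} (hS : MeasurableSet S)
    (h : 100 * #{s | f s ∉ S} ≤ T) :
    99 / 100 ≤ ((PMF.uniformOfFintype (Fin T)).map f).toMeasure S := by
  rw [PMF.toMeasure_apply_eq_toOuterMeasure_apply _ hS, PMF.toOuterMeasure_map_apply,
    PMF.toOuterMeasure_uniformOfFintype_apply]
  have hc : Fintype.card (f ⁻¹' S : Set (Fin T)) = #{s | f s ∈ S} := by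
    rw [Fintype.card_subtype]
    rfl
  have hsum := Finset.card_filter_add_card_filter_not (s := (Finset.univ : Finset (Fin T)))
    (fun s => f s ∈ S)
  rw [Finset.card_univ, Fintype.card_fin] at hsum
  have hT : T ≠ 0 := NeZero.ne T
  rw [hc, Fintype.card_fin, ENNReal.le_div_iff_mul_le (by simp [hT]) (by simp),
    ENNReal.div_eq_inv_mul, mul_assoc, ENNReal.inv_mul_le_iff (by simp) (by simp)]
  have : 99 * T ≤ 100 * #{s | f s ∈ S} := by omega
  exact_mod_cast this

open Classical in
/-- Compilation of a family of sketches `F ω` into a streaming algorithm: it suffices that `F ω` can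
be updated from its value when a clause is appended, and that it takes few values. -/
theorem exists_streaming {k n : ℕ} {Ω σ : Type*} [Fintype Ω] [Nonempty Ω]
    (V : Finset (Instance k n)) (hpre : ∀ Ψ C, Ψ ++ [C] ∈ V → Ψ ∈ V)
    (F : Ω → Instance k n → σ)
    (hF : ∀ ω Ψ Ψ' C, F ω Ψ = F ω Ψ' → F ω (Ψ ++ [C]) = F ω (Ψ' ++ [C]))
    (R : Finset σ) (hR : ∀ ω, ∀ Ψ ∈ V, F ω Ψ ∈ R) (out : Ω → σ → ℝ)
    (good : Instance k n → Set ℝ) (hmeas : ∀ Ψ, MeasurableSet (good Ψ))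
    (hgood : ∀ Ψ ∈ V, Ψ ≠ [] → 1000 * #{ω | out ω (F ω Ψ) ∉ good Ψ} ≤ Fintype.card Ω)
    (N : ℕ) (hV : #V ≤ 2 ^ N) (s : ℕ) (hs : 500 * (N + 1) * #R ≤ 2 ^ s) :
    ∃ (init : PMF (Fin s → Bool)) (step : (Fin s → Bool) → Clause k n → PMF (Fin s → Bool))
      (output : (Fin s → Bool) → ℝ), ∀ Ψ ∈ V, Ψ ≠ [] →
        99 / 100 ≤ ((Ψ.foldl (fun μ C => μ.bind fun x => step x C) init).map output).toMeasure
          (good Ψ) := by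
  have hseeds := exists_seeds (V.filter fun Ψ => Ψ ≠ [])
    (fun Ψ ω => out ω (F ω Ψ) ∉ good Ψ)
    (fun Ψ hΨ => by
      have := hgood Ψ (Finset.mem_filter.1 hΨ).1 (Finset.mem_filter.1 hΨ).2
      convert this) N
    ((Finset.card_filter_le _ _).trans hV)
  obtain ⟨T, hT⟩ : ∃ T, T = 500 * (N + 1) := ⟨_, rfl⟩
  rw [← hT] at hseeds hs
  obtain ⟨g, hg⟩ := hseeds
  have : NeZero T := ⟨by omega⟩
  obtain ⟨e⟩ : Nonempty (Fin T × R ↪ (Fin s → Bool)) :=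
    Function.Embedding.nonempty_of_card_le (by simpa using hs)
  -- The memory holds the seed index and the sketch value. The default branch is never reached on
  -- streams in `V`.
  let code : Fin T → Instance k n → (Fin s → Bool) := fun t Ψ =>
    if h : F (g t) Ψ ∈ R then e (t, ⟨_, h⟩) else fun _ => false
  have hcode : ∀ t t' Ψ Ψ', Ψ ∈ V → Ψ' ∈ V → code t Ψ = code t' Ψ' →
      t = t' ∧ F (g t) Ψ = F (g t') Ψ' := by
    intro t t' Ψ Ψ' h h' heq
    simp only [code, hR _ _ h, hR _ _ h', dif_pos] at heq
    have := e.injective heq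
    simpa using this
  let init : PMF (Fin s → Bool) := (PMF.uniformOfFintype (Fin T)).map fun t => code t []
  -- A representative stream with the current memory state is chosen, and `C` is appended to it. By
  -- `hF` the new state does not depend on the choice. All randomness lies in the initial seed
  -- index.
  let step : (Fin s → Bool) → Clause k n → PMF (Fin s → Bool) := fun x C =>
    if h : ∃ tΨ : Fin T × Instance k n, tΨ.2 ∈ V ∧ code tΨ.1 tΨ.2 = x
    then PMF.pure (code h.choose.1 (h.choose.2 ++ [C])) else PMF.pure x
  let output : (Fin s → Bool) → ℝ := fun x =>
    if h : ∃ tΨ : Fin T × Instance k n, tΨ.2 ∈ V ∧ code tΨ.1 tΨ.2 = x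
    then out (g h.choose.1) (F (g h.choose.1) h.choose.2) else 0
  have hstep : ∀ t Ψ C, Ψ ∈ V → step (code t Ψ) C = PMF.pure (code t (Ψ ++ [C])) := by
    intro t Ψ C hΨ
    have h : ∃ tΨ : Fin T × Instance k n, tΨ.2 ∈ V ∧ code tΨ.1 tΨ.2 = code t Ψ := ⟨(t, Ψ), hΨ, rfl⟩
    have h1 := hcode _ _ _ _ h.choose_spec.1 hΨ h.choose_spec.2
    have h2 : F (g t) (h.choose.2 ++ [C]) = F (g t) (Ψ ++ [C]) := by
      refine hF _ _ _ _ ?_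
      rw [← h1.2, h1.1]
    simp only [step, dif_pos h, code, h1.1, h2]
  have hout : ∀ t Ψ, Ψ ∈ V → output (code t Ψ) = out (g t) (F (g t) Ψ) := by
    intro t Ψ hΨ
    have h : ∃ tΨ : Fin T × Instance k n, tΨ.2 ∈ V ∧ code tΨ.1 tΨ.2 = code t Ψ := ⟨(t, Ψ), hΨ, rfl⟩
    have h1 := hcode _ _ _ _ h.choose_spec.1 hΨ h.choose_spec.2
    simp only [output, dif_pos h]
    rw [h1.2, h1.1]
  have hfold : ∀ Ψ ∈ V, Ψ.foldl (fun μ C => μ.bind fun x => step x C) init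
      = (PMF.uniformOfFintype (Fin T)).map fun t => code t Ψ := by
    intro Ψ
    induction Ψ using List.reverseRecOn with
    | nil => intro _; rfl
    | append_singleton Ψ C ih =>
      intro h
      have hΨ := hpre Ψ C h
      rw [List.foldl_append, ih hΨ]
      simp only [List.foldl_cons, List.foldl_nil]
      rw [PMF.bind_map]
      have : ((fun x => step x C) ∘ fun t => code t Ψ)
          = PMF.pure ∘ fun t => code t (Ψ ++ [C]) := by
        funext t
        exact hstep t Ψ C hΨ
      rw [this, PMF.bind_pure_comp]
  refine ⟨init, step, output, fun Ψ hΨ h0 => ?_⟩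
  rw [hfold Ψ hΨ, PMF.map_comp]
  have : (output ∘ fun t => code t Ψ) = fun t => out (g t) (F (g t) Ψ) := by
    funext t
    exact hout t Ψ hΨ
  rw [this]
  refine toMeasure_map_uniform _ (hmeas Ψ) ?_
  convert hg Ψ (Finset.mem_filter.2 ⟨hΨ, h0⟩)

end MaxAnd

/-! ### Second moments of the sampling process -/

namespace MaxAnd

open Finset

section Average

variable {Ω : Type*} [Fintype Ω]

/-- The expectation of `f` under the uniform distribution. -/
noncomputable def avg (f : Ω → ℝ) : ℝ := (∑ ω, f ω) / Fintype.card Ω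

lemma avg_sum {ι : Type*} (s : Finset ι) (f : ι → Ω → ℝ) :
    avg (fun ω => ∑ i ∈ s, f i ω) = ∑ i ∈ s, avg (f i) := by
  simp only [avg]
  rw [Finset.sum_comm, Finset.sum_div]

lemma avg_const_mul (c : ℝ) (f : Ω → ℝ) : avg (fun ω => c * f ω) = c * avg f := by
  simp only [avg]
  rw [← Finset.mul_sum, mul_div_assoc]

lemma avg_sub (f g : Ω → ℝ) : avg (fun ω => f ω - g ω) = avg f - avg g := by
  simp only [avg]
  rw [Finset.sum_sub_distrib, sub_div]

lemma avg_add (f g : Ω → ℝ) : avg (fun ω => f ω + g ω) = avg f + avg g := by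
  simp only [avg]
  rw [Finset.sum_add_distrib, add_div]

lemma avg_const [Nonempty Ω] (c : ℝ) : avg (fun _ : Ω => c) = c := by
  have : (Fintype.card Ω : ℝ) ≠ 0 := by exact_mod_cast Fintype.card_ne_zero
  simp [avg, this]

open Classical in
lemma card_mul_le_avg [Nonempty Ω] (X : Ω → ℝ) (hX : ∀ ω, 0 ≤ X ω) (B : ℝ) :
    (#{ω | B ≤ X ω} : ℝ) * B ≤ avg X * Fintype.card Ω := by
  have : (Fintype.card Ω : ℝ) ≠ 0 := by exact_mod_cast Fintype.card_ne_zero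
  rw [avg, div_mul_cancel₀ _ this]
  calc (#{ω | B ≤ X ω} : ℝ) * B = ∑ ω ∈ {ω | B ≤ X ω}, B := by simp
    _ ≤ ∑ ω ∈ {ω | B ≤ X ω}, X ω := Finset.sum_le_sum fun ω h => (Finset.mem_filter.1 h).2
    _ ≤ ∑ ω, X ω := Finset.sum_le_sum_of_subset_of_nonneg (Finset.filter_subset _ _)
        fun ω _ _ => hX ω

end Average

section Product

variable {ι : Type*} {Q : ℕ}

/-- The probability that a uniformly random element of `Fin Q` lies in `T i`. -/
noncomputable def density (T : ι → Finset (Fin Q)) (i : ι) : ℝ := (#(T i) : ℝ) / Q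

lemma density_le_one [NeZero Q] (T : ι → Finset (Fin Q)) (i : ι) : density T i ≤ 1 := by
  have h := Finset.card_le_univ (T i)
  rw [Fintype.card_fin] at h
  have hQ : (0 : ℝ) < Q := by exact_mod_cast Nat.pos_of_ne_zero (NeZero.ne Q)
  rw [density, div_le_one hQ]
  exact_mod_cast h

variable [Fintype ι] [DecidableEq ι] [NeZero Q]

lemma avg_forall_mem (T : ι → Finset (Fin Q)) (A : Finset ι) :
    avg (fun ω : ι → Fin Q => if ∀ i ∈ A, ω i ∈ T i then (1 : ℝ) else 0)
      = ∏ i ∈ A, density T i := by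
  have hQ : (Q : ℝ) ≠ 0 := by exact_mod_cast NeZero.ne Q
  have h1 : (Finset.univ.filter fun ω : ι → Fin Q => ∀ i ∈ A, ω i ∈ T i)
      = Fintype.piFinset fun i => if i ∈ A then T i else Finset.univ := by
    ext ω
    simp only [Finset.mem_filter, Finset.mem_univ, true_and, Fintype.mem_piFinset]
    refine forall_congr' fun i => ?_
    by_cases h : i ∈ A <;> simp [h]
  rw [avg, Finset.sum_boole, h1, Fintype.card_piFinset, Fintype.card_pi]
  push_cast
  rw [← Finset.prod_div_distrib, ← Finset.prod_subset (Finset.subset_univ A)]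
  · refine Finset.prod_congr rfl fun i hi => ?_
    simp [hi, density]
  · intro i _ hi
    simp [hi, hQ]

variable {τ : Type*} [Fintype τ]

/-- The square expands into covariances. The joint probability of two events is the product of
densities over the union of their supports, so `r t t'` bounds the covariance; weights in [0, 1] do
not increase that bound. -/
lemma avg_sq_le (T : ι → Finset (Fin Q)) (A : τ → Finset ι) (w : τ → ℝ) (hw0 : ∀ t, 0 ≤ w t)
    (hw1 : ∀ t, w t ≤ 1) (c : ℝ) (hc : ∀ t, ∏ i ∈ A t, density T i = c) (r : τ → τ → ℝ)
    (hr0 : ∀ t t', 0 ≤ r t t')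
    (hr : ∀ t t', ∏ i ∈ A t ∪ A t', density T i ≤ c * c + r t t') :
    avg (fun ω : ι → Fin Q =>
      (∑ t, w t * (if ∀ i ∈ A t, ω i ∈ T i then (1 : ℝ) else 0) - c * ∑ t, w t) ^ 2)
      ≤ ∑ t, ∑ t', r t t' := by
  have h1 : ∀ ω : ι → Fin Q,
      (∑ t, w t * (if ∀ i ∈ A t, ω i ∈ T i then (1 : ℝ) else 0) - c * ∑ t, w t) ^ 2
      = ∑ t, ∑ t', w t * w t' * ((if ∀ i ∈ A t ∪ A t', ω i ∈ T i then (1 : ℝ) else 0)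
        - c * (if ∀ i ∈ A t, ω i ∈ T i then (1 : ℝ) else 0)
        - c * (if ∀ i ∈ A t', ω i ∈ T i then (1 : ℝ) else 0) + c * c) := by
    intro ω
    have h2 : ∑ t, w t * (if ∀ i ∈ A t, ω i ∈ T i then (1 : ℝ) else 0) - c * ∑ t, w t
        = ∑ t, w t * ((if ∀ i ∈ A t, ω i ∈ T i then (1 : ℝ) else 0) - c) := by
      rw [Finset.mul_sum, ← Finset.sum_sub_distrib]
      exact Finset.sum_congr rfl fun t _ => by ring
    rw [h2, sq, Finset.sum_mul_sum]
    refine Finset.sum_congr rfl fun t _ => Finset.sum_congr rfl fun t' _ => ?_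
    have h3 : (if ∀ i ∈ A t ∪ A t', ω i ∈ T i then (1 : ℝ) else 0)
        = (if ∀ i ∈ A t, ω i ∈ T i then (1 : ℝ) else 0)
          * (if ∀ i ∈ A t', ω i ∈ T i then (1 : ℝ) else 0) := by
      simp only [Finset.mem_union, or_imp, forall_and]
      split_ifs <;> simp_all
    rw [h3]
    ring
  simp only [h1, avg_sum]
  refine Finset.sum_le_sum fun t _ => Finset.sum_le_sum fun t' _ => ?_
  rw [avg_const_mul, avg_add, avg_sub, avg_sub, avg_const_mul, avg_const_mul, avg_const,
    avg_forall_mem, avg_forall_mem, avg_forall_mem, hc, hc]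
  have h4 : ∏ i ∈ A t ∪ A t', density T i - c * c - c * c + c * c ≤ r t t' := by
    linarith [hr t t']
  have h5 : 0 ≤ w t * w t' := mul_nonneg (hw0 _) (hw0 _)
  have h6 : w t * w t' ≤ 1 := mul_le_one₀ (hw1 _) (hw0 _) (hw1 _)
  calc _ ≤ w t * w t' * r t t' := mul_le_mul_of_nonneg_left h4 h5
    _ ≤ 1 * r t t' := mul_le_mul_of_nonneg_right h6 (hr0 _ _)
    _ = _ := one_mul _

end Product

section Sampling

variable {k n m M Q : ℕ}

/-- The coordinates on which the survival of the clause `C` arriving at time `t` depends. -/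
def support (C : Clause k n) (t : Fin M) : Finset (Fin n ⊕ Fin M) :=
  (vars C).disjSum {t}

/-- Variables survive if their coordinate lies in `S`, arrival times if it lies in `U`. -/
def survival (S U : Finset (Fin Q)) : Fin n ⊕ Fin M → Finset (Fin Q) :=
  Sum.elim (fun _ => S) fun _ => U

lemma prod_support (S U : Finset (Fin Q)) (C : Clause k n) (t : Fin M) :
    ∏ i ∈ support C t, density (survival S U) i = ((#S : ℝ) / Q) ^ k * ((#U : ℝ) / Q) := by
  rw [support, Finset.prod_disjSum]
  simp [density, survival, card_vars, div_pow]

lemma prod_support_union (S U : Finset (Fin Q)) (C C' : Clause k n) (t t' : Fin M) (h : t ≠ t') :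
    ∏ i ∈ support C t ∪ support C' t', density (survival S U) i
      = ((#S : ℝ) / Q) ^ #(vars C ∪ vars C') * ((#U : ℝ) / Q) ^ 2 := by
  have : support C t ∪ support C' t' = (vars C ∪ vars C').disjSum {t, t'} := by
    ext i
    rcases i with i | i <;> simp [support]
  rw [this, Finset.prod_disjSum]
  simp [density, survival, Finset.prod_pair h, sq, div_pow]

lemma card_intersecting_le {D : ℕ} (C : Fin m → Clause k n)
    (hD : ∀ v, #{t | v ∈ vars (C t)} ≤ D) (t : Fin m) :
    #{t' | ¬ Disjoint (vars (C t)) (vars (C t'))} ≤ k * D := by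
  have : (Finset.univ.filter fun t' => ¬ Disjoint (vars (C t)) (vars (C t')))
      ⊆ (vars (C t)).biUnion fun v => {t' | v ∈ vars (C t')} := by
    intro t' ht'
    obtain ⟨v, hv, hv'⟩ := Finset.not_disjoint_iff.1 (Finset.mem_filter.1 ht').2
    exact Finset.mem_biUnion.2 ⟨v, hv, Finset.mem_filter.2 ⟨Finset.mem_univ _, hv'⟩⟩
  calc _ ≤ _ := Finset.card_le_card this
    _ ≤ ∑ v ∈ vars (C t), #{t' | v ∈ vars (C t')} := Finset.card_biUnion_le
    _ ≤ ∑ v ∈ vars (C t), D := Finset.sum_le_sum fun v _ => hD v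
    _ = k * D := by rw [Finset.sum_const, card_vars, smul_eq_mul]

variable [NeZero Q]

/-- The variance of the weighted number of surviving clauses. -/
lemma avg_sq_survivors_le {D : ℕ} (C : Fin m → Clause k n) (hD : ∀ v, #{t | v ∈ vars (C t)} ≤ D)
    (e : Fin m → Fin M) (he : Function.Injective e) (S U : Finset (Fin Q)) (w : Fin m → ℝ)
    (hw0 : ∀ t, 0 ≤ w t) (hw1 : ∀ t, w t ≤ 1) (p q : ℝ) (hp : (#S : ℝ) / Q = p)
    (hq : (#U : ℝ) / Q = q) :
    avg (fun ω : Fin n ⊕ Fin M → Fin Q => (∑ t, w t *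
      (if ∀ i ∈ support (C t) (e t), ω i ∈ survival S U i then (1 : ℝ) else 0)
        - p ^ k * q * ∑ t, w t) ^ 2)
      ≤ (if p ^ k * q = 1 then 0 else m * (p ^ k * q))
        + if p = 1 then 0 else m * (k * D) * (q * (p ^ k * q)) := by
  have hp0 : 0 ≤ p := by rw [← hp]; positivity
  have hq0 : 0 ≤ q := by rw [← hq]; positivity
  have hp1 : p ≤ 1 := hp ▸ density_le_one (fun _ : Unit => S) ()
  have hq1 : q ≤ 1 := hq ▸ density_le_one (fun _ : Unit => U) ()
  have hπ0 : 0 ≤ p ^ k * q := by positivity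
  -- The diagonal contributes p^k q per clause. Distinct clauses with a common variable survive
  -- jointly with probability at most p^k q², and each clause meets at most kD clauses. Either term
  -- is set to 0 when the corresponding sampling is trivial: short streams need exactly zero
  -- variance.
  refine (avg_sq_le (survival S U) (fun t => support (C t) (e t)) w hw0 hw1 (p ^ k * q)
    (fun t => by rw [prod_support, hp, hq])
    (fun t t' => (if t = t' then (if p ^ k * q = 1 then 0 else p ^ k * q) else 0)
      + if ¬ Disjoint (vars (C t)) (vars (C t')) then (if p = 1 then 0 else q * (p ^ k * q)) else 0)
    (fun t t' => ?_) (fun t t' => ?_)).trans ?_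
  · positivity
  · have hr2 : 0 ≤ (if ¬ Disjoint (vars (C t)) (vars (C t')) then
        (if p = 1 then 0 else q * (p ^ k * q)) else 0) := by positivity
    by_cases h : t = t'
    · subst h
      rw [Finset.union_self, prod_support, hp, hq]
      simp only [if_true]
      split_ifs with h1 <;> nlinarith [mul_nonneg hπ0 hπ0]
    · rw [prod_support_union _ _ _ _ _ _ (fun hh => h (he hh)), hp, hq, if_neg h, zero_add]
      by_cases hd : Disjoint (vars (C t)) (vars (C t'))
      · rw [Finset.card_union_of_disjoint hd, card_vars, card_vars]
        simp only [hd, not_true_eq_false, if_false]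
        apply le_of_eq
        ring
      · simp only [hd, not_false_eq_true, if_true]
        by_cases h1 : p = 1
        · simp [h1, sq]
        · rw [if_neg h1]
          have : p ^ #(vars (C t) ∪ vars (C t')) ≤ p ^ k := by
            refine pow_le_pow_of_le_one hp0 hp1 ?_
            have := Finset.card_le_card (Finset.subset_union_left (s₁ := vars (C t))
              (s₂ := vars (C t')))
            rwa [card_vars] at this
          nlinarith [mul_nonneg hπ0 hπ0, mul_le_mul_of_nonneg_right this (sq_nonneg q)]
  · simp only [Finset.sum_add_distrib]
    refine add_le_add ?_ ?_
    · simp only [Finset.sum_ite_eq, Finset.mem_univ, if_true, Finset.sum_const, Finset.card_univ,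
        Fintype.card_fin, nsmul_eq_mul]
      split_ifs <;> simp
    · by_cases h1 : p = 1
      · simp [h1]
      · simp only [h1, if_false]
        have hb : 0 ≤ q * (p ^ k * q) := mul_nonneg hq0 hπ0
        calc _ = ∑ t, (#{t' | ¬ Disjoint (vars (C t)) (vars (C t'))} : ℝ) * (q * (p ^ k * q)) := by
              refine Finset.sum_congr rfl fun t _ => ?_
              rw [← Finset.sum_filter, Finset.sum_const, nsmul_eq_mul]
          _ ≤ ∑ t : Fin m, (k * D : ℝ) * (q * (p ^ k * q)) := by
              refine Finset.sum_le_sum fun t _ => mul_le_mul_of_nonneg_right ?_ hb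
              exact_mod_cast card_intersecting_le C hD t
          _ = _ := by
              simp only [Finset.sum_const, Finset.card_univ, Fintype.card_fin, nsmul_eq_mul]
              ring

lemma avg_card_survivors (C : Fin m → Clause k n) (e : Fin m → Fin M) (S U : Finset (Fin Q)) :
    avg (fun ω : Fin n ⊕ Fin M → Fin Q => ∑ t : Fin m,
      if ∀ i ∈ support (C t) (e t), ω i ∈ survival S U i then (1 : ℝ) else 0)
      = m * (((#S : ℝ) / Q) ^ k * ((#U : ℝ) / Q)) := by
  rw [avg_sum]
  simp only [avg_forall_mem, prod_support]
  simp

lemma avg_card_vars (A : Finset (Fin n)) (S : Finset (Fin Q)) :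
    avg (fun ω : Fin n ⊕ Fin M → Fin Q => (#{v ∈ A | ω (Sum.inl v) ∈ S} : ℝ))
      = #A * ((#S : ℝ) / Q) := by
  have : ∀ ω : Fin n ⊕ Fin M → Fin Q, (#{v ∈ A | ω (Sum.inl v) ∈ S} : ℝ)
      = ∑ v ∈ A, if ∀ i ∈ ({Sum.inl v} : Finset (Fin n ⊕ Fin M)), ω i ∈ S then (1 : ℝ) else 0 := by
    intro ω
    simp [Finset.sum_boole]
  simp only [this]
  rw [avg_sum]
  have h2 := fun v => avg_forall_mem (fun _ : Fin n ⊕ Fin M => S) ({Sum.inl v})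
  simp only [h2]
  simp [density]

end Sampling

end MaxAnd

/-! ### Counting sparse tables, clauses and streams -/

namespace MaxAnd

open Finset

section Sparse

variable {X : Type*} [Fintype X]

open Classical in
/-- The nonzero entries of a table. -/
noncomputable def entries (f : X → ℕ) : Finset X := {x | f x ≠ 0}

open Classical in
/-- A table that is dropped when it has more than `B` nonzero entries. -/
noncomputable def capped (B : ℕ) (f : X → ℕ) : Option (X → ℕ) :=
  if #(entries f) ≤ B then some f else none

/-- The number of nonzero entries only grows, so a dropped table stays dropped. This makes the
truncated sketch updatable. -/
lemma capped_add_congr (B : ℕ) {f f' : X → ℕ} (e : X → ℕ) (h : capped B f = capped B f') :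
    capped B (f + e) = capped B (f' + e) := by
  have hmono : ∀ g : X → ℕ, #(entries g) ≤ #(entries (g + e)) := fun g =>
    Finset.card_le_card fun x hx => by
      simp only [entries, Finset.mem_filter, Finset.mem_univ, true_and, Pi.add_apply] at hx ⊢
      omega
  have h1 := hmono f
  have h2 := hmono f'
  unfold capped at *
  by_cases hf : #(entries f) ≤ B <;> by_cases hf' : #(entries f') ≤ B
  · simp only [hf, hf', if_true, Option.some.injEq] at h
    rw [h]
  · simp [hf, hf'] at h
  · simp [hf, hf'] at h
  · rw [if_neg (by omega), if_neg (by omega)]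

-- Induction on `B`: resetting one nonzero entry to zero leaves a sparser table, from which the
-- original is recovered by a position and a value.
open Classical in
lemma exists_finset_sparse (V B : ℕ) : ∃ Z : Finset (X → ℕ),
    #Z ≤ (Fintype.card X * (V + 1) + 1) ^ B ∧
      ∀ f : X → ℕ, (∀ x, f x ≤ V) → #(entries f) ≤ B → f ∈ Z := by
  induction B with
  | zero =>
    refine ⟨{0}, by simp, fun f _ h => ?_⟩
    rw [Nat.le_zero, Finset.card_eq_zero] at h
    refine Finset.mem_singleton.2 (funext fun x => ?_)
    by_contra hx
    have : x ∈ entries f := by simpa [entries] using hx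
    simp [h] at this
  | succ B ih =>
    obtain ⟨Z, hZ, hmem⟩ := ih
    refine ⟨Z ∪ (Z ×ˢ (Finset.univ ×ˢ Finset.range (V + 1))).image
      (fun y => Function.update y.1 y.2.1 y.2.2), ?_, fun f hV hB => ?_⟩
    · refine (Finset.card_union_le _ _).trans ?_
      refine (Nat.add_le_add_left Finset.card_image_le _).trans ?_
      rw [Finset.card_product, Finset.card_product, Finset.card_univ, Finset.card_range, pow_succ]
      calc _ = #Z * (Fintype.card X * (V + 1) + 1) := by ring
        _ ≤ _ := Nat.mul_le_mul_right _ hZ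
    · rcases hB.lt_or_eq with h | h
      · exact Finset.mem_union_left _ (hmem f hV (by omega))
      · have hne : (entries f).Nonempty := by rw [← Finset.card_pos]; omega
        obtain ⟨x, hx⟩ := hne
        refine Finset.mem_union_right _ (Finset.mem_image.2
          ⟨(Function.update f x 0, x, f x), Finset.mem_product.2 ⟨hmem _ (fun y => ?_) ?_,
            Finset.mem_product.2 ⟨Finset.mem_univ _, Finset.mem_range.2 ?_⟩⟩, by simp⟩)
        · by_cases hy : y = x
          · simp [hy]
          · simpa [hy] using hV y
        · have : entries (Function.update f x 0) ⊆ (entries f).erase x := by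
            intro y hy
            by_cases hyx : y = x <;> simp_all [entries]
          have := Finset.card_le_card this
          rw [Finset.card_erase_of_mem hx] at this
          change #(entries (Function.update f x 0)) ≤ B
          omega
        · exact Nat.lt_succ_of_le (hV x)

open Classical in
lemma exists_finset_capped (V : ℕ) {B : ℕ} (hB : B ≠ 0) : ∃ Z : Finset (Option (X → ℕ)),
    #Z ≤ (Fintype.card X * (V + 1) + 2) ^ B ∧
      ∀ f : X → ℕ, (∀ x, f x ≤ V) → capped B f ∈ Z := by
  obtain ⟨Z, hZ, hmem⟩ := exists_finset_sparse (X := X) V B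
  refine ⟨Finset.insertNone Z, ?_, fun f hf => ?_⟩
  · rw [Finset.card_insertNone]
    calc #Z + 1 ≤ (Fintype.card X * (V + 1) + 1) ^ B + 1 ^ B := by simpa using hZ
      _ ≤ (Fintype.card X * (V + 1) + 1 + 1) ^ B := pow_add_pow_le (by omega) (by omega) hB
      _ = _ := rfl
  · unfold capped
    split_ifs with h
    · simpa using hmem f hf h
    · simp

end Sparse

section Clauses

variable {k n : ℕ}

noncomputable instance : Fintype (Clause k n) :=
  Fintype.ofInjective (fun C : Clause k n => (C.pos, C.neg)) (by
    rintro ⟨a, b, _, _⟩ ⟨c, d, _, _⟩ h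
    simpa using h)

/-- A clause is determined by any `k`-tuple that enumerates its signed variables. -/
lemma card_clause_le : Fintype.card (Clause k n) ≤ (2 * n) ^ k := by
  classical
  have hex : ∀ C : Clause k n, ∃ g : Fin k → Bool × Fin n,
      ∀ b v, v ∈ lits C b ↔ (b, v) ∈ Set.range g := by
    intro C
    obtain ⟨e⟩ : Nonempty (Fin k ≃ vars C) := ⟨((vars C).equivFinOfCardEq (card_vars C)).symm⟩
    refine ⟨fun i => (decide ((e i : Fin n) ∈ C.pos), e i), fun b v => ?_⟩
    have hd := not_mem_neg C v
    simp only [Set.mem_range, Prod.mk.injEq]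
    constructor
    · intro h
      have hv : v ∈ vars C := (mem_vars_iff C v b).2 (Or.inl h)
      refine ⟨e.symm ⟨v, hv⟩, ?_, by simp⟩
      cases b <;> simp_all [lits]
    · rintro ⟨i, h1, rfl⟩
      have := (e i).2
      simp only [vars, Finset.mem_union] at this
      cases b <;> simp_all [lits]
      tauto
  choose g hg using hex
  have hinj : Function.Injective g := by
    rintro C C' h
    have h1 : ∀ b, lits C b = lits C' b := fun b => by
      ext v
      rw [hg, hg, h]
    have h2 := h1 true
    have h3 := h1 false
    simp only [lits, if_true, Bool.false_eq_true, if_false] at h2 h3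
    rcases C with ⟨a, b, _, _⟩
    rcases C' with ⟨c, d, _, _⟩
    simp_all
  have := Fintype.card_le_of_injective g hinj
  simpa using this

lemma degree_eq_add (Ψ : Instance k n) (v : Fin n) (b : Bool) :
    Ψ.degree v = litCount Ψ v b + litCount Ψ v (!b) := by
  classical
  rw [Instance.degree, litCount, litCount]
  induction Ψ with
  | nil => simp
  | cons C Ψ ih =>
    simp only [List.countP_cons, ih, decide_eq_true_eq]
    have h1 := mem_vars_iff C v b
    have h2 := not_mem_lits_both C v b
    rw [vars] at h1
    split_ifs <;> first | omega | tauto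

lemma litCount_append (Ψ : Instance k n) (C : Clause k n) (v : Fin n) (b : Bool) :
    litCount (Ψ ++ [C]) v b = litCount Ψ v b + if v ∈ lits C b then 1 else 0 := by
  simp [litCount, List.countP_append, List.countP_cons]

lemma maxDegreeLE_of_append {D : ℕ} (Ψ : Instance k n) (C : Clause k n)
    (h : Instance.MaxDegreeLE (Ψ ++ [C]) D) : Instance.MaxDegreeLE Ψ D := by
  intro v
  refine le_trans ?_ (h v)
  rw [degree_eq_add _ v true, degree_eq_add _ v true, litCount_append, litCount_append]
  omega

lemma sum_degree (Ψ : Instance k n) : ∑ v, Ψ.degree v = k * Ψ.length := by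
  classical
  simp only [Instance.degree]
  induction Ψ with
  | nil => simp
  | cons C Ψ ih =>
    simp only [List.countP_cons, decide_eq_true_eq, Finset.sum_add_distrib, ih, List.length_cons]
    rw [Finset.sum_boole, Finset.filter_mem_eq_inter, Finset.univ_inter, C.card_eq]
    simp [mul_add]

lemma length_le_of_maxDegreeLE {D : ℕ} (hk : 0 < k) (Ψ : Instance k n) (h : Ψ.MaxDegreeLE D) :
    Ψ.length ≤ D * n := by
  have h1 := Finset.sum_le_sum fun v (_ : v ∈ (Finset.univ : Finset (Fin n))) => h v
  rw [sum_degree] at h1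
  simp only [Finset.sum_const, Finset.card_univ, Fintype.card_fin, smul_eq_mul] at h1
  nlinarith

end Clauses

section Lists

variable {α : Type*} [Fintype α]

open Classical in
lemma exists_finset_lists (M : ℕ) : ∃ Z : Finset (List α),
    #Z ≤ 2 ^ (M * (Fintype.card α + 1)) ∧ ∀ l, l ∈ Z ↔ l.length ≤ M := by
  let enc : List α → (Fin M → Option α) := fun l t => l[(t : ℕ)]?
  have hinj : Set.InjOn enc {l | l.length ≤ M} := by
    intro l hl l' hl' h
    refine List.ext_getElem? fun i => ?_
    by_cases hi : i < M
    · exact congrFun h ⟨i, hi⟩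
    · rw [Set.mem_ofPred_eq] at hl hl'
      rw [List.getElem?_eq_none (by omega), List.getElem?_eq_none (by omega)]
  have hfin : {l : List α | l.length ≤ M}.Finite :=
    Set.Finite.of_finite_image (Set.toFinite _) hinj
  refine ⟨hfin.toFinset, ?_, fun l => by simp⟩
  calc #hfin.toFinset ≤ #(Finset.univ : Finset (Fin M → Option α)) :=
        Finset.card_le_card_of_injOn enc (fun _ _ => Finset.mem_coe.2 (Finset.mem_univ _))
          (by simpa using hinj)
    _ = (Fintype.card α + 1) ^ M := by simp
    _ ≤ (2 ^ (Fintype.card α + 1)) ^ M := Nat.pow_le_pow_left (Nat.lt_two_pow_self.le) _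
    _ = _ := by rw [← pow_mul, mul_comm]

end Lists

end MaxAnd

/-! ### The sketch and the accuracy of its estimate -/

namespace MaxAnd

open Finset

variable {k n M Q : ℕ}

/-- The literal degrees of the surviving variables. -/
def litTable (S : Finset (Fin Q)) (ω : Fin n ⊕ Fin M → Fin Q) (Ψ : Instance k n) :
    Fin n × Bool → ℕ :=
  fun x => if ω (Sum.inl x.1) ∈ S then litCount Ψ x.1 x.2 else 0

/-- The clause `C`, arriving at time `t`, survives. -/
def Survives (S U : Finset (Fin Q)) (ω : Fin n ⊕ Fin M → Fin Q) (C : Clause k n) (t : ℕ) : Prop :=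
  ∃ h : t < M, ∀ i ∈ support C ⟨t, h⟩, ω i ∈ survival S U i

open Classical in
/-- The surviving clauses, with multiplicity. -/
noncomputable def clauseTable (S U : Finset (Fin Q)) (ω : Fin n ⊕ Fin M → Fin Q)
    (Ψ : Instance k n) : Clause k n → ℕ :=
  fun C => #{t ∈ range Ψ.length | Ψ[t]? = some C ∧ Survives S U ω C t}

lemma litTable_append (S : Finset (Fin Q)) (ω : Fin n ⊕ Fin M → Fin Q) (Ψ : Instance k n)
    (C : Clause k n) : litTable S ω (Ψ ++ [C]) = litTable S ω Ψ +
      fun x => if ω (Sum.inl x.1) ∈ S then (if x.1 ∈ lits C x.2 then 1 else 0) else 0 := by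
  funext x
  simp only [litTable, Pi.add_apply, litCount_append]
  split_ifs <;> rfl

open Classical in
lemma clauseTable_append (S U : Finset (Fin Q)) (ω : Fin n ⊕ Fin M → Fin Q) (Ψ : Instance k n)
    (C : Clause k n) : clauseTable S U ω (Ψ ++ [C]) = clauseTable S U ω Ψ +
      fun C' => if C = C' ∧ Survives S U ω C' Ψ.length then 1 else 0 := by
  funext C'
  simp only [clauseTable, Pi.add_apply, List.length_append, List.length_singleton]
  rw [Finset.range_add_one, Finset.filter_insert]
  have h1 : (Ψ ++ [C])[Ψ.length]? = some C := by simp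
  have h2 : ({t ∈ range Ψ.length | (Ψ ++ [C])[t]? = some C' ∧ Survives S U ω C' t} : Finset ℕ)
      = {t ∈ range Ψ.length | Ψ[t]? = some C' ∧ Survives S U ω C' t} := by
    refine Finset.filter_congr fun t ht => ?_
    rw [List.getElem?_append_left (Finset.mem_range.1 ht)]
  rw [h1, h2]
  simp only [Option.some.injEq]
  split_ifs
  · rw [Finset.card_insert_of_notMem (by simp)]
  · simp

/-- The memory contents after `Ψ`: the number of clauses, the literal degrees of the variables
sampled at each of the levels `0, …, ℓ`, and the clauses sampled at each scale `j < J`. -/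
noncomputable def sketch (S U : ℕ → Finset (Fin Q)) (B : ℕ → ℕ) (L ℓ J : ℕ)
    (ω : Fin n ⊕ Fin M → Fin Q) (Ψ : Instance k n) :
    ℕ × (Fin (ℓ + 1) → Option (Fin n × Bool → ℕ)) × (Fin J → Option (Clause k n → ℕ)) :=
  (Ψ.length, fun l => capped (B l) (litTable (S l) ω Ψ),
    fun j => capped L (clauseTable (S (min j ℓ)) (U j) ω Ψ))

lemma sketch_congr (S U : ℕ → Finset (Fin Q)) (B : ℕ → ℕ) (L ℓ J : ℕ)
    (ω : Fin n ⊕ Fin M → Fin Q) (Ψ Ψ' : Instance k n) (C : Clause k n)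
    (h : sketch S U B L ℓ J ω Ψ = sketch S U B L ℓ J ω Ψ') :
    sketch S U B L ℓ J ω (Ψ ++ [C]) = sketch S U B L ℓ J ω (Ψ' ++ [C]) := by
  simp only [sketch, Prod.mk.injEq] at h ⊢
  obtain ⟨h1, h2, h3⟩ := h
  refine ⟨by simp [h1], funext fun l => ?_, funext fun j => ?_⟩
  · rw [litTable_append, litTable_append]
    exact capped_add_congr _ _ (congrFun h2 l)
  · rw [clauseTable_append, clauseTable_append, h1]
    exact capped_add_congr _ _ (congrFun h3 j)

lemma litTable_le {D : ℕ} (S : Finset (Fin Q)) (ω : Fin n ⊕ Fin M → Fin Q) (Ψ : Instance k n)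
    (h : Ψ.MaxDegreeLE D) (x : Fin n × Bool) : litTable S ω Ψ x ≤ D := by
  have h1 := h x.1
  rw [degree_eq_add _ _ x.2] at h1
  unfold litTable
  split_ifs <;> omega

lemma clauseTable_le (S U : Finset (Fin Q)) (ω : Fin n ⊕ Fin M → Fin Q) (Ψ : Instance k n)
    (C : Clause k n) : clauseTable S U ω Ψ C ≤ Ψ.length := by
  classical
  exact (Finset.card_filter_le _ _).trans (Finset.card_range _).le

open Classical in
lemma exists_finset_sketch {D : ℕ} (S U : ℕ → Finset (Fin Q)) (B : ℕ → ℕ) (L ℓ J : ℕ)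
    (hB : ∀ l, B l ≠ 0) (hL : L ≠ 0) :
    ∃ R : Finset (ℕ × (Fin (ℓ + 1) → Option (Fin n × Bool → ℕ)) ×
      (Fin J → Option (Clause k n → ℕ))),
      #R ≤ (M + 1) * ((n * 2 * (D + 1) + 2) ^ (∑ l ∈ range (ℓ + 1), B l) *
        (Fintype.card (Clause k n) * (M + 1) + 2) ^ (L * J)) ∧
      ∀ (ω : Fin n ⊕ Fin M → Fin Q) (Ψ : Instance k n), Ψ.length ≤ M → Ψ.MaxDegreeLE D →
        sketch S U B L ℓ J ω Ψ ∈ R := by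
  choose Z hZ hZmem using fun l => exists_finset_capped (X := Fin n × Bool) D (hB l)
  obtain ⟨W, hW, hWmem⟩ := exists_finset_capped (X := Clause k n) M hL
  refine ⟨range (M + 1) ×ˢ (Fintype.piFinset fun l : Fin (ℓ + 1) => Z l) ×ˢ
    (Fintype.piFinset fun _ : Fin J => W), ?_, fun ω Ψ hM hD => ?_⟩
  · rw [Finset.card_product, Finset.card_product, Finset.card_range, Fintype.card_piFinset,
      Fintype.card_piFinset]
    refine Nat.mul_le_mul_left _ (Nat.mul_le_mul ?_ ?_)
    · calc ∏ l : Fin (ℓ + 1), #(Z l) ≤ ∏ l : Fin (ℓ + 1), (n * 2 * (D + 1) + 2) ^ B l := by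
            refine Finset.prod_le_prod' fun l _ => ?_
            simpa using hZ l
        _ = _ := by rw [Finset.prod_pow_eq_pow_sum, Finset.sum_range]
    · rw [Finset.prod_const, Finset.card_univ, Fintype.card_fin, pow_mul]
      exact Nat.pow_le_pow_left hW J
  · simp only [sketch, Finset.mem_product, Finset.mem_range, Fintype.mem_piFinset]
    exact ⟨by omega, fun l => hZmem l _ (litTable_le _ _ _ hD),
      fun j => hWmem _ fun C => (clauseTable_le _ _ _ _ _).trans hM⟩

open Classical in
lemma sum_clauseTable_mul (S U : Finset (Fin Q)) (ω : Fin n ⊕ Fin M → Fin Q) (Ψ : Instance k n)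
    (hM : Ψ.length ≤ M) (g : Clause k n → ℝ) :
    ∑ C, (clauseTable S U ω Ψ C : ℝ) * g C = ∑ t : Fin Ψ.length, g Ψ[t] *
      if ∀ i ∈ support Ψ[t] (Fin.castLE hM t), ω i ∈ survival S U i then 1 else 0 := by
  have h1 : ∀ C, (clauseTable S U ω Ψ C : ℝ) = ∑ t : Fin Ψ.length,
      if Ψ[t] = C ∧ Survives S U ω C t then (1 : ℝ) else 0 := by
    intro C
    rw [clauseTable, ← Finset.sum_boole, Finset.sum_range]
    refine Finset.sum_congr rfl fun t _ => ?_
    simp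
  simp only [h1, Finset.sum_mul]
  rw [Finset.sum_comm]
  refine Finset.sum_congr rfl fun t _ => ?_
  rw [Finset.sum_eq_single Ψ[t]]
  · have : Survives S U ω Ψ[t] t ↔
        ∀ i ∈ support Ψ[t] (Fin.castLE hM t), ω i ∈ survival S U i :=
      ⟨fun ⟨_, h⟩ => h, fun h => ⟨t.2.trans_le hM, h⟩⟩
    simp only [true_and, this]
    ring
  · intro C _ hC
    rw [if_neg fun h => hC h.1.symm, zero_mul]
  · simp

/-- The number of survivors among the clauses of `Ψ`, weighted by `g`. -/
noncomputable def survivors (S U : Finset (Fin Q)) (Ψ : Instance k n) (hM : Ψ.length ≤ M)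
    (g : Clause k n → ℝ) (ω : Fin n ⊕ Fin M → Fin Q) : ℝ :=
  ∑ t : Fin Ψ.length, g Ψ[t] *
    if ∀ i ∈ support Ψ[t] (Fin.castLE hM t), ω i ∈ survival S U i then 1 else 0

lemma card_entries_clauseTable_le (S U : Finset (Fin Q)) (ω : Fin n ⊕ Fin M → Fin Q)
    (Ψ : Instance k n) (hM : Ψ.length ≤ M) :
    (#(entries (clauseTable S U ω Ψ)) : ℝ) ≤ survivors S U Ψ hM (fun _ => 1) ω := by
  classical
  have h := sum_clauseTable_mul S U ω Ψ hM fun _ => 1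
  have h2 : ∑ C, (clauseTable S U ω Ψ C : ℝ) * 1 = survivors S U Ψ hM (fun _ => 1) ω := by
    rw [h, survivors]
  rw [← h2, entries, ← Finset.sum_boole]
  refine Finset.sum_le_sum fun C _ => ?_
  split_ifs with hC
  · rw [mul_one]
    exact_mod_cast Nat.one_le_iff_ne_zero.2 hC
  · positivity

open Classical in
/-- The variables that occur in `Ψ`. -/
noncomputable def seen (Ψ : Instance k n) : Finset (Fin n) := {v | Ψ.degree v ≠ 0}

lemma card_seen_le (Ψ : Instance k n) : #(seen Ψ) ≤ k * Ψ.length := by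
  classical
  rw [← sum_degree, seen, Finset.card_filter]
  refine Finset.sum_le_sum fun v _ => ?_
  split_ifs <;> omega

lemma card_entries_litTable_le (S : Finset (Fin Q)) (ω : Fin n ⊕ Fin M → Fin Q)
    (Ψ : Instance k n) :
    #(entries (litTable S ω Ψ)) ≤ 2 * #{v ∈ seen Ψ | ω (Sum.inl v) ∈ S} := by
  classical
  have : entries (litTable S ω Ψ)
      ⊆ ({v ∈ seen Ψ | ω (Sum.inl v) ∈ S} : Finset (Fin n)) ×ˢ (Finset.univ : Finset Bool) := by
    rintro ⟨v, b⟩ h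
    simp only [entries, litTable, Finset.mem_filter, Finset.mem_univ, true_and, ne_eq,
      ite_eq_right_iff, not_forall] at h
    obtain ⟨h1, h2⟩ := h
    simp only [Finset.mem_product, Finset.mem_filter, Finset.mem_univ, and_true, seen, true_and]
    refine ⟨?_, h1⟩
    rw [degree_eq_add _ _ b]
    omega
  refine (Finset.card_le_card this).trans ?_
  rw [Finset.card_product]
  simp [mul_comm]

/-- The rounding probabilities computed from a table of literal degrees. -/
noncomputable def tableProb (r ρ : ℝ) (f : Fin n × Bool → ℕ) (v : Fin n) : ℝ :=
  roundProb r ρ (f (v, true)) (f (v, false))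

/-- The estimate computed from a sketch in which clauses survive with probability `π j` at
scale `j`, for the average clause weight; it is lowered by `δ`. -/
noncomputable def estimate (r ρ δ : ℝ) (π : ℕ → ℝ) (ℓ J : ℕ)
    (s : ℕ × (Fin (ℓ + 1) → Option (Fin n × Bool → ℕ)) × (Fin J → Option (Clause k n → ℕ))) : ℝ :=
  if h : Nat.log 2 s.1 < J then
    match s.2.1 ⟨min (Nat.log 2 s.1) ℓ, by omega⟩, s.2.2 ⟨Nat.log 2 s.1, h⟩ with
    | some f, some κ =>
      (∑ C, (κ C : ℝ) * weight (tableProb r ρ f) C) / (s.1 * π (Nat.log 2 s.1)) - δ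
    | _, _ => 0
  else 0

lemma weight_congr {P P' : Fin n → ℝ} (C : Clause k n) (h : ∀ v ∈ vars C, P v = P' v) :
    weight P C = weight P' C := by
  unfold weight
  congr 1
  · exact Finset.prod_congr rfl fun v hv => h v (Finset.mem_union_left _ hv)
  · exact Finset.prod_congr rfl fun v hv => by rw [h v (Finset.mem_union_right _ hv)]

/-- A surviving clause has all its variables in the sample `S l`, where the final literal counts are
exact. So its weight from the table is the true weight, although the counts were incomplete when the
clause arrived. -/
lemma estimate_sketch (S U : ℕ → Finset (Fin Q)) (B : ℕ → ℕ) (L ℓ J : ℕ) (r ρ δ : ℝ) (π : ℕ → ℝ)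
    (ω : Fin n ⊕ Fin M → Fin Q) (Ψ : Instance k n) (hM : Ψ.length ≤ M) {j l : ℕ}
    (hj : Nat.log 2 Ψ.length = j) (hl : min j ℓ = l) (hJ : j < J)
    (hB : #(entries (litTable (S l) ω Ψ)) ≤ B l)
    (hL : #(entries (clauseTable (S l) (U j) ω Ψ)) ≤ L) :
    estimate r ρ δ π ℓ J (sketch S U B L ℓ J ω Ψ) =
      survivors (S l) (U j) Ψ hM (weight fun v => roundProb r ρ (litCount Ψ v true)
        (litCount Ψ v false)) ω / (Ψ.length * π j) - δ := by
  classical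
  subst hj hl
  have h1 : capped (B (min (Nat.log 2 Ψ.length) ℓ))
      (litTable (S (min (Nat.log 2 Ψ.length) ℓ)) ω Ψ)
      = some (litTable (S (min (Nat.log 2 Ψ.length) ℓ)) ω Ψ) := if_pos hB
  have h2 : capped L (clauseTable (S (min (Nat.log 2 Ψ.length) ℓ)) (U (Nat.log 2 Ψ.length)) ω Ψ)
      = some (clauseTable (S (min (Nat.log 2 Ψ.length) ℓ)) (U (Nat.log 2 Ψ.length)) ω Ψ) :=
    if_pos hL
  simp only [estimate, sketch, dif_pos hJ, h1, h2]
  rw [sum_clauseTable_mul _ _ _ _ hM]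
  congr 2
  unfold survivors
  refine Finset.sum_congr rfl fun t _ => ?_
  by_cases h : ∀ i ∈ support Ψ[t] (Fin.castLE hM t),
      ω i ∈ survival (S (min (Nat.log 2 Ψ.length) ℓ)) (U (Nat.log 2 Ψ.length)) i
  · rw [if_pos h]
    congr 1
    refine weight_congr _ fun v hv => ?_
    have : ω (Sum.inl v) ∈ S (min (Nat.log 2 Ψ.length) ℓ) :=
      h (Sum.inl v) (by simp only [support, Finset.inl_mem_disjSum]; exact hv)
    simp [tableProb, litTable, this]
  · rw [if_neg h, mul_zero, mul_zero]

lemma degree_eq_card (Ψ : Instance k n) (v : Fin n) :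
    Ψ.degree v = #{t : Fin Ψ.length | v ∈ vars Ψ[t]} := by
  classical
  rw [Finset.card_filter, Instance.degree]
  have := Fin.sum_univ_fun_getElem Ψ fun C => if v ∈ vars C then 1 else 0
  simp only [Fin.getElem_fin]
  rw [this]
  clear this
  induction Ψ with
  | nil => rfl
  | cons C Ψ ih =>
    rw [List.countP_cons, ih, List.map_cons, List.sum_cons, add_comm]
    simp [vars]

open Classical in
/-- The estimate is accurate except with probability `1 / 1000`. -/
theorem card_bad_le [NeZero Q] {D : ℕ} (S U : ℕ → Finset (Fin Q)) (B : ℕ → ℕ) (L ℓ J : ℕ)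
    {r ρ δ : ℝ} (hr0 : 0 ≤ r) (hr1 : r ≤ 1) (hδ : 0 < δ) (π : ℕ → ℝ) (Ψ : Instance k n)
    (hM : Ψ.length ≤ M) (hD : Ψ.MaxDegreeLE D) {j l : ℕ} (hj : Nat.log 2 Ψ.length = j)
    (hl : min j ℓ = l) (hJ : j < J) (hB0 : 0 < B l) (hL0 : 0 < L) {p q O : ℝ}
    (hp : (#(S l) : ℝ) / Q = p) (hq : (#(U j) : ℝ) / Q = q) (hπ : p ^ k * q = π j)
    (hmπ : 0 < Ψ.length * π j) (hB : 8000 * (#(seen Ψ) * p) ≤ B l)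
    (hL : 4000 * (Ψ.length * π j) ≤ L)
    (hvar : 2000 * ((if π j = 1 then 0 else Ψ.length * π j) +
      if p = 1 then 0 else Ψ.length * (k * D) * (q * π j)) ≤ (δ * (Ψ.length * π j)) ^ 2)
    (hO : (Ψ.map (weight fun v => roundProb r ρ (litCount Ψ v true) (litCount Ψ v false))).sum
      = O * Ψ.length) :
    1000 * #{ω : Fin n ⊕ Fin M → Fin Q |
      estimate r ρ δ π ℓ J (sketch S U B L ℓ J ω Ψ) ∉ Set.Icc (O - 2 * δ) O}
      ≤ Fintype.card (Fin n ⊕ Fin M → Fin Q) := by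
  set w := weight (k := k) fun v => roundProb r ρ (litCount Ψ v true) (litCount Ψ v false) with hw
  have hw0 : ∀ C, 0 ≤ w C := weight_nonneg (fun v => roundProb_nonneg hr0 hr1 _ _)
    fun v => roundProb_le_one hr0 hr1 _ _
  have hw1 : ∀ C, w C ≤ 1 := weight_le_one (fun v => roundProb_nonneg hr0 hr1 _ _)
    fun v => roundProb_le_one hr0 hr1 _ _
  -- The bad events are overflow of the variable table (`E1`), overflow of the clause table (`E2`)
  -- and a deviation by δ (`E3`). Markov's inequality gives 1/4000 for each of the first two,
  -- Chebyshev's gives 1/2000 for the third. The threshold is `B l / 2` because a variable occupies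
  -- two table entries.
  set E1 : Finset (Fin n ⊕ Fin M → Fin Q) :=
    {ω | (B l : ℝ) / 2 ≤ (#{v ∈ seen Ψ | ω (Sum.inl v) ∈ S l} : ℝ)} with hE1
  set E2 : Finset (Fin n ⊕ Fin M → Fin Q) :=
    {ω | (L : ℝ) ≤ survivors (S l) (U j) Ψ hM (fun _ => 1) ω} with hE2
  set E3 : Finset (Fin n ⊕ Fin M → Fin Q) :=
    {ω | (δ * (Ψ.length * π j)) ^ 2 ≤
      (survivors (S l) (U j) Ψ hM w ω - π j * (O * Ψ.length)) ^ 2} with hE3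
  have hN : (0 : ℝ) ≤ Fintype.card (Fin n ⊕ Fin M → Fin Q) := Nat.cast_nonneg _
  have h1 : 4000 * (#E1 : ℝ) ≤ Fintype.card (Fin n ⊕ Fin M → Fin Q) := by
    have h := card_mul_le_avg (fun ω : Fin n ⊕ Fin M → Fin Q =>
      (#{v ∈ seen Ψ | ω (Sum.inl v) ∈ S l} : ℝ)) (fun ω => Nat.cast_nonneg _) ((B l : ℝ) / 2)
    rw [avg_card_vars, hp, ← hE1] at h
    have hb : (0 : ℝ) < B l := by exact_mod_cast hB0
    nlinarith [mul_le_mul_of_nonneg_right hB hN]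
  have h2 : 4000 * (#E2 : ℝ) ≤ Fintype.card (Fin n ⊕ Fin M → Fin Q) := by
    have h := card_mul_le_avg (survivors (M := M) (S l) (U j) Ψ hM fun _ => 1)
      (fun ω => Finset.sum_nonneg fun t _ => by positivity) (L : ℝ)
    have h' := avg_card_survivors (fun t : Fin Ψ.length => Ψ[t]) (Fin.castLE hM) (S l) (U j)
    rw [hp, hq, hπ] at h'
    have h'' : survivors (M := M) (S l) (U j) Ψ hM (fun _ => 1) = fun ω => ∑ t : Fin Ψ.length,
        if ∀ i ∈ support Ψ[t] (Fin.castLE hM t), ω i ∈ survival (S l) (U j) i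
        then (1 : ℝ) else 0 := by
      funext ω
      simp only [survivors, one_mul]
    rw [← hE2, h'', h'] at h
    have hb : (0 : ℝ) < L := by exact_mod_cast hL0
    nlinarith [mul_le_mul_of_nonneg_right hL hN]
  have h3 : 2000 * (#E3 : ℝ) ≤ Fintype.card (Fin n ⊕ Fin M → Fin Q) := by
    have h := card_mul_le_avg (fun ω : Fin n ⊕ Fin M → Fin Q =>
      (survivors (S l) (U j) Ψ hM w ω - π j * (O * Ψ.length)) ^ 2) (fun ω => sq_nonneg _)
      ((δ * (Ψ.length * π j)) ^ 2)
    have h' := avg_sq_survivors_le (fun t : Fin Ψ.length => Ψ[t])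
      (fun v => (degree_eq_card Ψ v).symm.trans_le (hD v)) (Fin.castLE hM)
      (Fin.castLE_injective hM) (S l) (U j) (fun t => w Ψ[t]) (fun t => hw0 _) (fun t => hw1 _)
      p q hp hq
    have hsum : ∑ t : Fin Ψ.length, w Ψ[t] = O * Ψ.length := by
      rw [← hO]
      exact Fin.sum_univ_fun_getElem Ψ w
    rw [hsum, hπ] at h'
    rw [← hE3] at h
    have hb : 0 < (δ * (Ψ.length * π j)) ^ 2 := by positivity
    have h4 := mul_le_mul_of_nonneg_right h' hN
    have h5 := mul_le_mul_of_nonneg_right hvar hN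
    have h6 : (#E3 : ℝ) * (δ * (Ψ.length * π j)) ^ 2 ≤ _ := h.trans h4
    refine le_of_mul_le_mul_right ?_ hb
    linarith
  have hsub : ({ω : Fin n ⊕ Fin M → Fin Q | estimate r ρ δ π ℓ J (sketch S U B L ℓ J ω Ψ)
      ∉ Set.Icc (O - 2 * δ) O} : Finset (Fin n ⊕ Fin M → Fin Q)) ⊆ E1 ∪ (E2 ∪ E3) := by
    intro ω hω
    by_contra hno
    simp only [Finset.mem_union, hE1, hE2, hE3, Finset.mem_filter, Finset.mem_univ, true_and,
      not_or, not_le] at hno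
    obtain ⟨g1, g2, g3⟩ := hno
    refine (Finset.mem_filter.1 hω).2 ?_
    have e1 : #(entries (litTable (S l) ω Ψ)) ≤ B l := by
      have h := card_entries_litTable_le (S l) ω Ψ
      have : (2 * #{v ∈ seen Ψ | ω (Sum.inl v) ∈ S l} : ℝ) < B l := by linarith
      have : 2 * #{v ∈ seen Ψ | ω (Sum.inl v) ∈ S l} < B l := by exact_mod_cast this
      omega
    have e2 : #(entries (clauseTable (S l) (U j) ω Ψ)) ≤ L := by
      have h := card_entries_clauseTable_le (S l) (U j) ω Ψ hM
      exact_mod_cast (h.trans_lt g2).le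
    rw [estimate_sketch S U B L ℓ J r ρ δ π ω Ψ hM hj hl hJ e1 e2, ← hw]
    have g4 := abs_lt_of_sq_lt_sq g3 (by positivity)
    rw [abs_lt] at g4
    rw [Set.mem_Icc, le_sub_iff_add_le, sub_le_iff_le_add, le_div_iff₀ hmπ, div_le_iff₀ hmπ]
    constructor <;> nlinarith [g4.1, g4.2]
  have hc : (#{ω : Fin n ⊕ Fin M → Fin Q | estimate r ρ δ π ℓ J (sketch S U B L ℓ J ω Ψ)
      ∉ Set.Icc (O - 2 * δ) O} : ℝ) ≤ #E1 + (#E2 + #E3) := by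
    have := (Finset.card_le_card hsub).trans ((Finset.card_union_le _ _).trans
      (Nat.add_le_add_left (Finset.card_union_le _ _) _))
    exact_mod_cast this
  have : (1000 : ℝ) * #{ω : Fin n ⊕ Fin M → Fin Q |
      estimate r ρ δ π ℓ J (sketch S U B L ℓ J ω Ψ) ∉ Set.Icc (O - 2 * δ) O}
      ≤ Fintype.card (Fin n ⊕ Fin M → Fin Q) := by linarith
  exact_mod_cast this

end MaxAnd

/-! ### Choice of the sampling rates, and integer memory bounds -/

namespace MaxAnd

open Finset

/-- Seed coordinates with 2^H values realize dyadic probabilities exactly. The condition on `a` is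
inside the existential so that a set can be chosen for every index. -/
lemma exists_finset_density (H a : ℕ) : ∃ S : Finset (Fin (2 ^ H)),
    a ≤ H → (#S : ℝ) / (2 ^ H : ℕ) = (1 / 2) ^ a := by
  by_cases h : a ≤ H
  · obtain ⟨S, -, hS⟩ := Finset.exists_subset_card_eq (s := (Finset.univ : Finset (Fin (2 ^ H))))
      (n := 2 ^ (H - a)) (by simpa using Nat.pow_le_pow_right (by norm_num) (Nat.sub_le H a))
    refine ⟨S, fun _ => ?_⟩
    obtain ⟨d, rfl⟩ := Nat.exists_eq_add_of_le h
    rw [hS, show a + d - a = d by omega]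
    push_cast
    rw [pow_add, one_div, inv_pow]
    field_simp
  · exact ⟨∅, fun h' => absurd h' h⟩

/-- The variables of level `l` are sampled with probability `2 ^ (- level k c l)`. -/
def level (k c l : ℕ) : ℕ := (l - c) / k

lemma level_le (k c l : ℕ) : level k c l ≤ l := (Nat.div_le_self _ _).trans (Nat.sub_le _ _)

lemma level_succ_le {k : ℕ} (hk : 2 ≤ k) (c l : ℕ) : level k c (l + 1) ≤ level k c l + 1 := by
  unfold level
  rw [← Nat.add_div_right _ (by omega : 0 < k)]
  exact Nat.div_le_div_right (by omega)

lemma level_add_two_le {k : ℕ} (hk : 2 ≤ k) (c l : ℕ) :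
    level k c (l + 2) ≤ level k c l + 1 := by
  unfold level
  rw [← Nat.add_div_right _ (by omega : 0 < k)]
  exact Nat.div_le_div_right (by omega)

/-- For k ≥ 2 the exponent grows by at least one in every two steps and never decreases, so the sum
is dominated geometrically by its last term. -/
lemma sum_two_pow_sub_level_le {k : ℕ} (hk : 2 ≤ k) (c ℓ : ℕ) :
    ∑ l ∈ range (ℓ + 1), 2 ^ (l - level k c l) ≤ 4 * 2 ^ (ℓ - level k c ℓ) := by
  induction ℓ using Nat.twoStepInduction with
  | zero => simp
  | one =>
    rw [Finset.sum_range_succ, Finset.sum_range_one]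
    have : (2 : ℕ) ^ (0 - level k c 0) ≤ 2 ^ (1 - level k c 1) :=
      Nat.pow_le_pow_right (by norm_num) (by omega)
    omega
  | more ℓ ih _ =>
    rw [Finset.sum_range_succ _ (ℓ + 2), Finset.sum_range_succ _ (ℓ + 1)]
    have h0 := level_le k c ℓ
    have h1 := level_le k c (ℓ + 1)
    have h2 : level k c (ℓ + 2) ≤ level k c (ℓ + 1) + 1 := level_succ_le hk c (ℓ + 1)
    have h3 := level_add_two_le hk c ℓ
    have e1 : (2 : ℕ) ^ (ℓ + 1 - level k c (ℓ + 1)) ≤ 2 ^ (ℓ + 2 - level k c (ℓ + 2)) :=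
      Nat.pow_le_pow_right (by norm_num) (by omega)
    have e2 : (2 : ℕ) ^ (ℓ - level k c ℓ + 1) ≤ 2 ^ (ℓ + 2 - level k c (ℓ + 2)) :=
      Nat.pow_le_pow_right (by norm_num) (by omega)
    rw [pow_succ] at e2
    omega

/-- At scale `j`, clauses are sampled with probability `2 ^ (- rate c c' ℓ j)`. -/
def rate (c c' ℓ j : ℕ) : ℕ := j - (min j ℓ - c) - c'

section Exponents

variable {k : ℕ} (c c' ℓ j : ℕ)

lemma level_mul_le : k * level k c (min j ℓ) ≤ min j ℓ - c := Nat.mul_div_le _ _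

lemma le_level_mul (hk : 0 < k) (l : ℕ) : l - c + 1 ≤ k * level k c l + k := by
  have := Nat.lt_div_mul_add (a := l - c) hk
  unfold level
  rw [mul_comm]
  omega

/-- The exponent of the survival probability is kept within k + 1 of j - c', apart from truncation
at 0. This side says that at most 2^{k+c'} clauses survive on average. `exponent_lower` gives at
least 2^{c'} when clauses are dropped at all, and `exponent_level` gives mP^k ≥ 2^c, for variable
probability P, when variables are dropped. -/
lemma exponent_upper (hk : 0 < k) :
    j + 1 ≤ k + c' + (k * level k c (min j ℓ) + rate c c' ℓ j) := by
  have h := le_level_mul c hk (min j ℓ)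
  unfold rate
  omega

lemma exponent_lower (hc : c' ≤ c) (h0 : k * level k c (min j ℓ) + rate c c' ℓ j ≠ 0) :
    c' + (k * level k c (min j ℓ) + rate c c' ℓ j) ≤ j := by
  have h := level_mul_le (k := k) c ℓ j
  unfold rate at *
  omega

lemma exponent_level (hk : 0 < k) (h0 : level k c (min j ℓ) ≠ 0) :
    c + k * level k c (min j ℓ) ≤ j := by
  have h := level_mul_le (k := k) c ℓ j
  have : 0 < k * level k c (min j ℓ) := by positivity
  omega

end Exponents

lemma mul_half_pow_le {m : ℝ} {a b e : ℕ} (hm : m ≤ 2 ^ a) (h : a ≤ b + e) :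
    m * (1 / 2) ^ e ≤ 2 ^ b := by
  rw [one_div, inv_pow, ← div_eq_mul_inv, div_le_iff₀ (by positivity), ← pow_add]
  exact hm.trans (pow_le_pow_right₀ (by norm_num) h)

lemma le_mul_half_pow {m : ℝ} {a b e : ℕ} (hm : 2 ^ a ≤ m) (h : b + e ≤ a) :
    2 ^ b ≤ m * (1 / 2) ^ e := by
  rw [one_div, inv_pow, ← div_eq_mul_inv, le_div_iff₀ (by positivity), ← pow_add]
  exact (pow_le_pow_right₀ (by norm_num) h).trans hm

lemma half_pow_eq_one_iff (e : ℕ) : ((1 / 2 : ℝ)) ^ e = 1 ↔ e = 0 := by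
  constructor
  · intro h
    by_contra h0
    exact absurd h (pow_lt_one₀ (by norm_num) (by norm_num) h0).ne
  · rintro rfl
    simp

lemma pow_add_one_le {M : ℕ} (hM : 2 ≤ M) (e : ℕ) : M ^ e + 1 ≤ M ^ (e + 1) := by
  have : 1 ≤ M ^ e := Nat.one_le_pow _ _ (by omega)
  rw [pow_succ]
  nlinarith

lemma clog_le_mul {x M e : ℕ} (h : x ≤ M ^ e) : Nat.clog 2 x ≤ e * Nat.clog 2 M := by
  refine Nat.clog_le_of_le_pow (h.trans ?_)
  rw [mul_comm, pow_mul]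
  exact Nat.pow_le_pow_left (Nat.le_pow_clog (by norm_num) M) e

lemma clog_seeds_le {M k x : ℕ} (hM : 4 ≤ M) (hx : x ≤ M ^ k) :
    Nat.clog 2 (500 * (M * (x + 1) + 1) * (M + 1)) ≤ (k + 10) * Nat.clog 2 M := by
  refine clog_le_mul ?_
  have e0 : M + 1 ≤ M ^ 2 := by simpa using pow_add_one_le (by omega : 2 ≤ M) 1
  have e1 : 500 ≤ M ^ 5 := le_trans (by norm_num) (Nat.pow_le_pow_left hM 5)
  have e2 : M * (x + 1) + 1 ≤ M ^ (k + 3) := by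
    calc M * (x + 1) + 1 ≤ M * (M ^ k + 1) + 1 := by gcongr
      _ ≤ M * M ^ (k + 1) + 1 := by gcongr; exact pow_add_one_le (by omega) k
      _ = M ^ (k + 2) + 1 := by ring
      _ ≤ _ := pow_add_one_le (by omega) _
  calc _ ≤ M ^ 5 * M ^ (k + 3) * M ^ 2 := by gcongr
    _ = M ^ (k + 10) := by ring

lemma clog_lits_le {n D : ℕ} (hn : 2 ≤ n) (hD : 2 ≤ D) :
    Nat.clog 2 (n * 2 * (D + 1) + 2) ≤ 3 * Nat.clog 2 (D * n) := by
  refine clog_le_mul ?_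
  have hM : 4 ≤ D * n := by nlinarith
  calc n * 2 * (D + 1) + 2 ≤ 4 * (D * n) := by nlinarith
    _ ≤ (D * n) * (D * n) := Nat.mul_le_mul_right _ hM
    _ ≤ (D * n) ^ 3 := by rw [← sq]; exact Nat.pow_le_pow_right (by omega) (by norm_num)

lemma clog_clauses_le {M k x : ℕ} (hM : 4 ≤ M) (hx : x ≤ M ^ k) :
    Nat.clog 2 (x * (M + 1) + 2) ≤ (k + 3) * Nat.clog 2 M := by
  refine clog_le_mul ?_
  have e0 : M + 1 ≤ M ^ 2 := by simpa using pow_add_one_le (by omega : 2 ≤ M) 1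
  have e1 : 1 ≤ M ^ (k + 2) := Nat.one_le_pow _ _ (by omega)
  calc x * (M + 1) + 2 ≤ M ^ k * M ^ 2 + 2 := by gcongr
    _ = M ^ (k + 2) + 2 := by ring
    _ ≤ M ^ (k + 2) * 4 := by omega
    _ ≤ M ^ (k + 2) * M := Nat.mul_le_mul_left _ hM
    _ = M ^ (k + 3) := by ring

lemma space_le {k f lam L J B x₁ x₂ x₃ : ℕ} (h0 : 0 < lam) (h1 : x₁ ≤ (k + 10) * lam)
    (h2 : x₂ ≤ 3 * lam) (h3 : x₃ ≤ (k + 3) * lam) (h4 : J ≤ 2 * lam) (h5 : B ≤ 64000 * k * f) :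
    x₁ + B * x₂ + L * J * x₃
      ≤ ((k + 10) + 3 * (64000 * k) + 2 * (k + 3) * L) * (lam * (lam + f)) := by
  have e1 : lam ≤ lam * (lam + f) := Nat.le_mul_of_pos_right _ (by omega)
  have e2 : lam * f ≤ lam * (lam + f) := Nat.mul_le_mul_left _ (by omega)
  have e3 : lam * lam ≤ lam * (lam + f) := Nat.mul_le_mul_left _ (by omega)
  calc x₁ + B * x₂ + L * J * x₃
      ≤ (k + 10) * lam + 64000 * k * f * (3 * lam) + L * (2 * lam) * ((k + 3) * lam) := by gcongr
    _ = (k + 10) * lam + 3 * (64000 * k) * (lam * f) + 2 * (k + 3) * L * (lam * lam) := by ring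
    _ ≤ (k + 10) * (lam * (lam + f)) + 3 * (64000 * k) * (lam * (lam + f))
        + 2 * (k + 3) * L * (lam * (lam + f)) := by gcongr
    _ = _ := by ring

/-- Each variance term takes half of the Chebyshev budget. The diagonal term needs 2^{c'} of order
δ^{-2}, the intersecting pairs need 2^c of order kD/δ². -/
lemma variance_le {k D c c' ℓ j : ℕ} {δ m : ℝ} (hδ : 0 < δ) (hk : 0 < k) (hcc : c' ≤ c)
    (hm : 2 ^ j ≤ m) (h1 : 4000 ≤ δ ^ 2 * 2 ^ c') (h2 : 4000 * (k * D : ℝ) ≤ δ ^ 2 * 2 ^ c) :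
    2000 * ((if ((1 / 2 : ℝ) ^ level k c (min j ℓ)) ^ k * (1 / 2) ^ rate c c' ℓ j = 1 then 0
        else m * (((1 / 2) ^ level k c (min j ℓ)) ^ k * (1 / 2) ^ rate c c' ℓ j)) +
      if (1 / 2 : ℝ) ^ level k c (min j ℓ) = 1 then 0 else m * (k * D) *
        ((1 / 2) ^ rate c c' ℓ j *
          (((1 / 2) ^ level k c (min j ℓ)) ^ k * (1 / 2) ^ rate c c' ℓ j))) ≤
      (δ * (m * (((1 / 2) ^ level k c (min j ℓ)) ^ k * (1 / 2) ^ rate c c' ℓ j))) ^ 2 := by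
  have hm0 : 0 < m := lt_of_lt_of_le (by positivity) hm
  set a := level k c (min j ℓ) with ha
  have hπ : ((1 / 2 : ℝ) ^ a) ^ k * (1 / 2) ^ rate c c' ℓ j
      = (1 / 2) ^ (k * a + rate c c' ℓ j) := by
    rw [← pow_mul, ← pow_add, mul_comm]
  set q : ℝ := (1 / 2) ^ rate c c' ℓ j with hq
  set p : ℝ := (1 / 2) ^ a with hp
  have hq0 : 0 < q := by positivity
  have hp0 : 0 < p := by positivity
  have t1 : 4000 * (if p ^ k * q = 1 then 0 else m * (p ^ k * q))
      ≤ (δ * (m * (p ^ k * q))) ^ 2 := by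
    split_ifs with h
    · rw [mul_zero]; positivity
    · rw [hπ, half_pow_eq_one_iff] at h
      have h3 := le_mul_half_pow hm (exponent_lower c c' ℓ j hcc h)
      rw [← ha, ← hπ] at h3
      have h4 : 4000 ≤ δ ^ 2 * (m * (p ^ k * q)) :=
        h1.trans (mul_le_mul_of_nonneg_left h3 (by positivity))
      have h5 : 0 ≤ m * (p ^ k * q) := by positivity
      calc _ ≤ _ := mul_le_mul_of_nonneg_right h4 h5
        _ = _ := by ring
  have t2 : 4000 * (if p = 1 then 0 else m * (k * D) * (q * (p ^ k * q)))
      ≤ (δ * (m * (p ^ k * q))) ^ 2 := by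
    split_ifs with h
    · rw [mul_zero]; positivity
    · rw [hp, half_pow_eq_one_iff] at h
      have h3 := le_mul_half_pow hm (exponent_level c ℓ j hk h)
      rw [← ha, mul_comm k a, pow_mul, ← hp] at h3
      have h4 : 4000 * (k * D) ≤ δ ^ 2 * (m * p ^ k) :=
        h2.trans (mul_le_mul_of_nonneg_left h3 (by positivity))
      have h5 : 0 ≤ m * q * (p ^ k * q) := by positivity
      calc _ = 4000 * (k * D) * (m * q * (p ^ k * q)) := by ring
        _ ≤ _ := mul_le_mul_of_nonneg_right h4 h5
        _ = _ := by ring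
  linarith

/-- At most min(n, km) variables occur in m clauses. The bound by n is why variable levels stop at
log n while the clause scales continue. -/
lemma seen_mul_le {k n j : ℕ} (hk : 0 < k) (c : ℕ) (Ψ : Instance k n)
    (hj : Ψ.length < 2 ^ (j + 1)) :
    8000 * ((#(seen Ψ) : ℝ) * (1 / 2) ^ level k c (min j (Nat.log 2 n))) ≤
      (8000 * k * 2 ^ (min j (Nat.log 2 n) + 1 - level k c (min j (Nat.log 2 n))) : ℕ) := by
  set ℓ := Nat.log 2 n
  have h1 : #(seen Ψ) ≤ k * 2 ^ (min j ℓ + 1) := by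
    rcases le_total j ℓ with hjl | hjl
    · rw [min_eq_left hjl]
      exact (card_seen_le Ψ).trans (Nat.mul_le_mul_left _ hj.le)
    · rw [min_eq_right hjl]
      have h2 : #(seen Ψ) ≤ n := (Finset.card_le_univ _).trans (by simp)
      have h3 : n < 2 ^ (ℓ + 1) := Nat.lt_pow_succ_log_self (by norm_num) n
      exact h2.trans (h3.le.trans (Nat.le_mul_of_pos_left _ hk))
  have h1' : (#(seen Ψ) : ℝ) ≤ k * 2 ^ (min j ℓ + 1) := by exact_mod_cast h1
  have h4 : (2 : ℝ) ^ (min j ℓ + 1) * (1 / 2) ^ level k c (min j ℓ)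
      ≤ 2 ^ (min j ℓ + 1 - level k c (min j ℓ)) :=
    mul_half_pow_le le_rfl (by omega)
  push_cast
  calc _ ≤ 8000 * ((k * 2 ^ (min j ℓ + 1)) * (1 / 2 : ℝ) ^ level k c (min j ℓ)) := by gcongr
    _ = 8000 * k * (2 ^ (min j ℓ + 1) * (1 / 2 : ℝ) ^ level k c (min j ℓ)) := by ring
    _ ≤ _ := by gcongr

/-- The average weight of the clauses of `Ψ` under the oblivious rounding. -/
noncomputable def obliviousValue {k n : ℕ} (r ρ : ℝ) (Ψ : Instance k n) : ℝ :=
  (Ψ.map (weight fun v => roundProb r ρ (litCount Ψ v true) (litCount Ψ v false))).sum / Ψ.length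

/-- Estimating the oblivious value, with the memory requirement expressed by integers. -/
theorem exists_estimator {k : ℕ} (hk : 2 ≤ k) {r ρ δ : ℝ} (hr0 : 0 ≤ r) (hr1 : r ≤ 1)
    (hδ : 0 < δ) : ∃ G K : ℕ, ∀ n D : ℕ, 2 ≤ n → 2 ≤ D →
      ∃ (s : ℕ) (init : PMF (Fin s → Bool))
        (step : (Fin s → Bool) → Clause k n → PMF (Fin s → Bool)) (output : (Fin s → Bool) → ℝ),
        s ≤ K * (Nat.clog 2 (D * n) * (Nat.clog 2 (D * n) +
          2 ^ (Nat.log 2 n - level k (Nat.clog 2 (G * k * D)) (Nat.log 2 n)))) ∧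
        ∀ Ψ : Instance k n, Ψ ≠ [] → Ψ.MaxDegreeLE D →
          99 / 100 ≤ ((Ψ.foldl (fun μ C => μ.bind fun x => step x C) init).map output).toMeasure
            (Set.Icc (obliviousValue r ρ Ψ - 2 * δ) (obliviousValue r ρ Ψ)) := by
  classical
  set G : ℕ := ⌈4000 / δ ^ 2⌉₊ with hG
  have hGδ : 4000 ≤ δ ^ 2 * G := by
    have := Nat.le_ceil (4000 / δ ^ 2)
    rw [← hG, div_le_iff₀ (by positivity)] at this
    linarith
  set c' := Nat.clog 2 G with hc'
  -- The Markov factor 4000 times the bound on the expected number of survivors.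
  set L : ℕ := 4000 * 2 ^ (k + c') with hL
  refine ⟨G, (k + 10) + 3 * (64000 * k) + 2 * (k + 3) * L, fun n D hn hD => ?_⟩
  set M := D * n with hM
  set ℓ := Nat.log 2 n with hℓ
  set c := Nat.clog 2 (G * k * D) with hc
  set J := Nat.log 2 M + 1 with hJ
  set f := 2 ^ (ℓ - level k c ℓ) with hf
  -- The Markov factor 8000 times a bound on the expected number of sampled variables at level `l`.
  set B : ℕ → ℕ := fun l => 8000 * k * 2 ^ (l + 1 - level k c l) with hB
  have hcc : c' ≤ c := by
    refine Nat.clog_mono_right 2 ?_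
    rw [mul_assoc]
    exact Nat.le_mul_of_pos_right _ (by positivity)
  have hM4 : 4 ≤ M := by rw [hM]; nlinarith
  choose S hS using fun l => exists_finset_density (ℓ + J) (level k c l)
  choose U hU using fun j => exists_finset_density (ℓ + J) (rate c c' ℓ j)
  obtain ⟨R, hR, hRmem⟩ := exists_finset_sketch (k := k) (n := n) (M := M) (D := D) S U B L ℓ J
    (fun l => by positivity) (by positivity)
  obtain ⟨V, hV, hVmem⟩ := exists_finset_lists (α := Clause k n) M
  set X := n * 2 * (D + 1) + 2 with hX
  set Y := Fintype.card (Clause k n) * (M + 1) + 2 with hY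
  set N := M * (Fintype.card (Clause k n) + 1) with hN
  set B' := ∑ l ∈ range (ℓ + 1), B l with hB'
  set s := Nat.clog 2 (500 * (N + 1) * (M + 1)) + B' * Nat.clog 2 X + L * J * Nat.clog 2 Y with hs
  have hcap : 500 * (N + 1) * #R ≤ 2 ^ s := by
    have hpow : ∀ x, x ≤ 2 ^ Nat.clog 2 x := fun x => Nat.le_pow_clog (by norm_num) x
    calc 500 * (N + 1) * #R ≤ 500 * (N + 1) * ((M + 1) * (X ^ B' * Y ^ (L * J))) :=
          Nat.mul_le_mul_left _ hR
      _ = 500 * (N + 1) * (M + 1) * X ^ B' * Y ^ (L * J) := by ring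
      _ ≤ 2 ^ Nat.clog 2 (500 * (N + 1) * (M + 1)) * (2 ^ Nat.clog 2 X) ^ B'
          * (2 ^ Nat.clog 2 Y) ^ (L * J) :=
          Nat.mul_le_mul (Nat.mul_le_mul (hpow _) (Nat.pow_le_pow_left (hpow _) _))
            (Nat.pow_le_pow_left (hpow _) _)
      _ = 2 ^ s := by
          rw [hs, pow_add, pow_add, ← pow_mul, ← pow_mul, mul_comm B', mul_comm (L * J)]
  have hspace : s ≤ ((k + 10) + 3 * (64000 * k) + 2 * (k + 3) * L) *
      (Nat.clog 2 M * (Nat.clog 2 M + f)) := by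
    have hcard : Fintype.card (Clause k n) ≤ M ^ k :=
      card_clause_le.trans (Nat.pow_le_pow_left (Nat.mul_le_mul_right n hD) k)
    have b4 : J ≤ 2 * Nat.clog 2 M := by
      have := Nat.log_le_clog 2 M
      have : 0 < Nat.clog 2 M := Nat.clog_pos (by norm_num) (by omega)
      omega
    have b5 : B' ≤ 64000 * k * f := by
      have h2 : B' = 16000 * k * ∑ l ∈ range (ℓ + 1), 2 ^ (l - level k c l) := by
        rw [hB', Finset.mul_sum]
        refine Finset.sum_congr rfl fun l _ => ?_
        have := level_le k c l
        change 8000 * k * 2 ^ (l + 1 - level k c l) = _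
        rw [show l + 1 - level k c l = (l - level k c l) + 1 by omega, pow_succ]
        ring
      rw [h2]
      calc _ ≤ 16000 * k * (4 * f) := Nat.mul_le_mul_left _ (sum_two_pow_sub_level_le hk c ℓ)
        _ = _ := by ring
    exact space_le (Nat.clog_pos (by norm_num) (by omega)) (clog_seeds_le hM4 hcard)
      (clog_lits_le hn hD) (clog_clauses_le hM4 hcard) b4 b5
  have hgood : ∀ Ψ ∈ V.filter fun Ψ => Instance.MaxDegreeLE Ψ D, Ψ ≠ [] →
      1000 * #{ω : Fin n ⊕ Fin M → Fin (2 ^ (ℓ + J)) |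
        estimate r ρ δ (fun j => ((1 / 2) ^ level k c (min j ℓ)) ^ k * (1 / 2) ^ rate c c' ℓ j) ℓ J
          (sketch S U B L ℓ J ω Ψ) ∉
            Set.Icc (obliviousValue r ρ Ψ - 2 * δ) (obliviousValue r ρ Ψ)}
        ≤ Fintype.card (Fin n ⊕ Fin M → Fin (2 ^ (ℓ + J))) := by
    intro Ψ hΨ h0
    rw [Finset.mem_filter, hVmem] at hΨ
    obtain ⟨hΨM, hΨD⟩ := hΨ
    have hpos : 0 < Ψ.length := List.length_pos_iff.2 h0
    set m := Ψ.length with hm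
    set j := Nat.log 2 m with hj
    have hm1 : 2 ^ j ≤ m := Nat.pow_log_le_self 2 hpos.ne'
    have hm2 : m < 2 ^ (j + 1) := Nat.lt_pow_succ_log_self (by norm_num) m
    have hm1' : (2 : ℝ) ^ j ≤ m := by exact_mod_cast hm1
    have hm2' : (m : ℝ) ≤ 2 ^ (j + 1) := by exact_mod_cast hm2.le
    have hmpos : (0 : ℝ) < m := by exact_mod_cast hpos
    have hjJ : j < J := Nat.lt_succ_of_le (Nat.log_mono_right hΨM)
    set a := level k c (min j ℓ) with ha
    have hπ : ((1 / 2 : ℝ) ^ a) ^ k * (1 / 2) ^ rate c c' ℓ j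
        = (1 / 2) ^ (k * a + rate c c' ℓ j) := by
      rw [← pow_mul, ← pow_add, mul_comm]
    refine card_bad_le S U B L ℓ J hr0 hr1 hδ _ Ψ hΨM hΨD hj.symm rfl hjJ (by positivity)
      (by positivity) (hS _ ((level_le _ _ _).trans (by omega)))
      (hU _ (le_trans (by unfold rate; omega) (by omega : j ≤ ℓ + J))) rfl
      ?_ ?_ ?_ ?_ ?_
    · positivity
    · exact seen_mul_le (by omega) c Ψ hm2
    · simp only [← hm, ← ha, hπ]
      rw [hL]
      push_cast
      exact mul_le_mul_of_nonneg_left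
        (mul_half_pow_le hm2' (exponent_upper c c' ℓ j (by omega))) (by norm_num)
    · exact variance_le hδ (by omega) hcc hm1' (hGδ.trans (mul_le_mul_of_nonneg_left
        (by exact_mod_cast Nat.le_pow_clog (by norm_num) G) (by positivity))) (by
          have h3 : ((G * k * D : ℕ) : ℝ) ≤ 2 ^ c := by
            exact_mod_cast Nat.le_pow_clog (by norm_num) _
          push_cast at h3
          calc 4000 * ((k : ℝ) * D) ≤ δ ^ 2 * G * (k * D) := by gcongr
            _ = δ ^ 2 * (G * k * D) := by ring
            _ ≤ _ := mul_le_mul_of_nonneg_left h3 (by positivity))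
    · rw [obliviousValue, div_mul_cancel₀ _ hmpos.ne']
  obtain ⟨init, step, output, h⟩ := exists_streaming (V.filter fun Ψ => Instance.MaxDegreeLE Ψ D)
    (fun Ψ C h => by
      rw [Finset.mem_filter, hVmem] at h ⊢
      refine ⟨?_, maxDegreeLE_of_append Ψ C h.2⟩
      have := h.1
      rw [List.length_append] at this
      omega)
    (fun ω : Fin n ⊕ Fin M → Fin (2 ^ (ℓ + J)) => sketch S U B L ℓ J ω)
    (fun ω Ψ Ψ' C h => sketch_congr S U B L ℓ J ω Ψ Ψ' C h) R
    (fun ω Ψ h => by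
      rw [Finset.mem_filter, hVmem] at h
      exact hRmem ω Ψ h.1 h.2)
    (fun _ => estimate r ρ δ (fun j => ((1 / 2) ^ level k c (min j ℓ)) ^ k *
      (1 / 2) ^ rate c c' ℓ j) ℓ J)
    (fun Ψ => Set.Icc (obliviousValue r ρ Ψ - 2 * δ) (obliviousValue r ρ Ψ))
    (fun Ψ => measurableSet_Icc)
    (fun Ψ hΨ h0 => by convert hgood Ψ hΨ h0) N ((Finset.card_filter_le _ _).trans hV) s hcap
  refine ⟨s, init, step, output, hspace, fun Ψ h0 hD' => h Ψ ?_ h0⟩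
  rw [Finset.mem_filter, hVmem]
  exact ⟨length_le_of_maxDegreeLE (by omega) Ψ hD', hD'⟩

end MaxAnd

/-! ### The memory bound in closed form -/

namespace MaxAnd

open Finset

lemma two_pow_clog_le (x : ℕ) : 2 ^ Nat.clog 2 x ≤ 2 * x + 1 := by
  rcases Nat.lt_or_ge 1 x with h | h
  · have h1 := Nat.pow_pred_clog_lt_self (by norm_num : 1 < 2) h
    obtain ⟨e, he⟩ := Nat.exists_eq_succ_of_ne_zero (Nat.clog_pos (by norm_num : 1 < 2) h).ne'
    rw [he] at h1 ⊢
    rw [Nat.pred_succ] at h1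
    rw [pow_succ]
    omega
  · simp [Nat.clog_of_right_le_one h]

lemma clog_le_log {M : ℕ} (hM : 4 ≤ M) : (Nat.clog 2 M : ℝ) ≤ 3 * Real.log M := by
  have h1 : 2 ^ Nat.clog 2 M ≤ M ^ 2 := by
    have := two_pow_clog_le M
    nlinarith
  have h2 : (2 : ℝ) ^ Nat.clog 2 M ≤ (M : ℝ) ^ 2 := by exact_mod_cast h1
  have h3 := Real.log_le_log (by positivity) h2
  rw [Real.log_pow, Real.log_pow] at h3
  push_cast at h3
  have h4 : (0 : ℝ) ≤ Nat.clog 2 M := Nat.cast_nonneg _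
  nlinarith [Real.log_two_gt_d9]

/-- The level at ℓ = log n is about (ℓ - c)/k, so k times the exponent is at most (k-1)ℓ + c + k,
where 2^c is of order GkD. -/
lemma two_pow_sub_level_pow_le {k : ℕ} (hk : 2 ≤ k) {G n D : ℕ} (hn : 2 ≤ n) (hD : 2 ≤ D) :
    (2 ^ (Nat.log 2 n - level k (Nat.clog 2 (G * k * D)) (Nat.log 2 n))) ^ k
      ≤ 2 ^ k * (2 * G * k + 1) * (D * n ^ (k - 1)) := by
  set ℓ := Nat.log 2 n
  set c := Nat.clog 2 (G * k * D)
  set a := level k c ℓ with ha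
  have h1 := le_level_mul (k := k) c (by omega) ℓ
  have h2 := level_le k c ℓ
  rw [← ha] at h1 h2
  obtain ⟨A, hA⟩ := Nat.exists_eq_add_of_le h2
  have h3 : k * ℓ = k * a + k * A := by rw [hA]; ring
  have h4 : (k - 1) * ℓ + ℓ = k * ℓ := by
    obtain ⟨k', rfl⟩ : ∃ k', k = k' + 1 := ⟨k - 1, by omega⟩
    simp
    ring
  have h5 : k * (ℓ - a) ≤ k + c + (k - 1) * ℓ := by
    rw [show ℓ - a = A by omega]
    omega
  have h6 : 2 ^ c ≤ (2 * G * k + 1) * D := by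
    have := two_pow_clog_le (G * k * D)
    calc 2 ^ c ≤ _ := this
      _ ≤ _ := by nlinarith
  have h7 : 2 ^ ℓ ≤ n := Nat.pow_log_le_self 2 (by omega)
  calc (2 ^ (ℓ - a)) ^ k = 2 ^ (k * (ℓ - a)) := by rw [← pow_mul, mul_comm]
    _ ≤ 2 ^ (k + c + (k - 1) * ℓ) := Nat.pow_le_pow_right (by norm_num) h5
    _ = 2 ^ k * 2 ^ c * (2 ^ ℓ) ^ (k - 1) := by rw [pow_add, pow_add, ← pow_mul, mul_comm ℓ]
    _ ≤ 2 ^ k * ((2 * G * k + 1) * D) * n ^ (k - 1) := by gcongr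
    _ = _ := by ring

lemma sq_log_le {k : ℕ} (hk : 2 ≤ k) {n D : ℝ} (hn : 1 ≤ n) (hD : 1 ≤ D) :
    Real.log (D * n) ^ 2 ≤ 4 * k ^ 2 * (D ^ (1 / (k : ℝ)) * n ^ (1 - 1 / (k : ℝ))) := by
  have hk' : (2 : ℝ) ≤ k := by exact_mod_cast hk
  have hx : 1 ≤ D * n := one_le_mul_of_one_le_of_one_le hD hn
  have h1 := Real.log_le_rpow_div (x := D * n) (ε := 1 / (2 * k)) (by linarith) (by positivity)
  have h2 : Real.log (D * n) ^ 2 ≤ ((D * n) ^ (1 / (2 * (k : ℝ))) / (1 / (2 * k))) ^ 2 :=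
    pow_le_pow_left₀ (Real.log_nonneg hx) h1 2
  have h3 : ((D * n) ^ (1 / (2 * (k : ℝ)))) ^ 2 = (D * n) ^ (1 / (k : ℝ)) := by
    rw [← Real.rpow_natCast, ← Real.rpow_mul (by linarith)]
    congr 1
    push_cast
    field_simp
  have h4 : n ^ (1 / (k : ℝ)) ≤ n ^ (1 - 1 / (k : ℝ)) := by
    refine Real.rpow_le_rpow_of_exponent_le hn ?_
    have : 1 / (k : ℝ) ≤ 1 / 2 := one_div_le_one_div_of_le (by norm_num) hk'
    linarith
  calc _ ≤ _ := h2
    _ = 4 * k ^ 2 * (D * n) ^ (1 / (k : ℝ)) := by rw [div_pow, h3]; field_simp; ring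
    _ = 4 * k ^ 2 * (D ^ (1 / (k : ℝ)) * n ^ (1 / (k : ℝ))) := by
        rw [Real.mul_rpow (by linarith) (by linarith)]
    _ ≤ _ := by gcongr

/-- The claimed bound has log n where the algorithm pays log(Dn). For D ≤ n these are comparable.
For D ≥ n the bound f ≤ n is better than `hfg`, and the factor (D/n)^{1/k} by which D^{1/k}
n^{1-1/k} exceeds n absorbs log(D/n). -/
lemma log_mul_le {k : ℕ} (hk : 2 ≤ k) {n D f C : ℝ} (hn : 2 ≤ n) (hD : 1 ≤ D) (hf : 0 ≤ f)
    (hfn : f ≤ n) (hC : 0 ≤ C) (hfg : f ≤ C * (D ^ (1 / (k : ℝ)) * n ^ (1 - 1 / (k : ℝ)))) :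
    Real.log (D * n) * f
      ≤ (2 * C + 2 + 2 * k) * (D ^ (1 / (k : ℝ)) * n ^ (1 - 1 / (k : ℝ)) * Real.log n) := by
  set g := D ^ (1 / (k : ℝ)) * n ^ (1 - 1 / (k : ℝ)) with hg
  have hk0 : (0 : ℝ) < k := by exact_mod_cast (by omega : 0 < k)
  have hg0 : 0 ≤ g := by positivity
  have hln : 1 / 2 ≤ Real.log n := by
    have := Real.log_le_log (by norm_num) hn
    linarith [Real.log_two_gt_d9]
  have hln0 : 0 ≤ Real.log n := by linarith
  have hgl : 0 ≤ g * Real.log n := by positivity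
  rw [Real.log_mul (by linarith) (by linarith)]
  rcases le_total D n with h | h
  · have h1 : Real.log D ≤ Real.log n := Real.log_le_log (by linarith) h
    have h2 : Real.log n * f ≤ Real.log n * (C * g) := mul_le_mul_of_nonneg_left hfg hln0
    have h3 : Real.log D * f ≤ Real.log n * f := mul_le_mul_of_nonneg_right h1 hf
    nlinarith
  · have hgn : g = n * (D / n) ^ (1 / (k : ℝ)) := by
      rw [hg, Real.div_rpow (by linarith) (by linarith), Real.rpow_sub (by linarith),
        Real.rpow_one]
      field_simp
    have hDn : 1 ≤ D / n := by rwa [one_le_div (by linarith)]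
    have h1 : 1 ≤ (D / n) ^ (1 / (k : ℝ)) := Real.one_le_rpow hDn (by positivity)
    have h2 : n ≤ g := by rw [hgn]; nlinarith
    have h3 : Real.log (D / n) ≤ k * (D / n) ^ (1 / (k : ℝ)) := by
      have := Real.log_le_rpow_div (x := D / n) (ε := 1 / k) (by linarith) (by positivity)
      calc _ ≤ _ := this
        _ = _ := by field_simp
    have h4 : Real.log D = Real.log (D / n) + Real.log n := by
      rw [Real.log_div (by linarith) (by linarith)]
      ring
    have h5 : Real.log (D / n) * f ≤ k * g := by
      have h6 : 0 ≤ (D / n) ^ (1 / (k : ℝ)) := by positivity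
      calc Real.log (D / n) * f ≤ Real.log (D / n) * n :=
            mul_le_mul_of_nonneg_left hfn (Real.log_nonneg hDn)
        _ ≤ k * (D / n) ^ (1 / (k : ℝ)) * n := mul_le_mul_of_nonneg_right h3 (by linarith)
        _ = k * g := by rw [hgn]; ring
    have h6 : k * g ≤ 2 * k * (g * Real.log n) := by
      have : 0 ≤ k * g := by positivity
      nlinarith
    have h7 : Real.log n * f ≤ Real.log n * g := mul_le_mul_of_nonneg_left (hfn.trans h2) hln0
    have h8 : 0 ≤ C * (g * Real.log n) := by positivity
    rw [h4]
    nlinarith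

/-- The memory requirement in closed form. -/
lemma exists_space_bound {k : ℕ} (hk : 2 ≤ k) (C : ℕ) : ∃ K : ℝ, 0 < K ∧
    ∀ n D f : ℕ, 2 ≤ n → 2 ≤ D → f ≤ n → f ^ k ≤ C * (D * n ^ (k - 1)) →
      ((Nat.clog 2 (D * n) * (Nat.clog 2 (D * n) + f) : ℕ) : ℝ) ≤
        K * ((D : ℝ) ^ (1 / (k : ℝ)) * (n : ℝ) ^ (1 - 1 / (k : ℝ)) * Real.log n) := by
  set C' : ℝ := (C : ℝ) ^ (1 / (k : ℝ)) with hC'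
  have hC0 : 0 ≤ C' := by positivity
  refine ⟨72 * k ^ 2 + 3 * (2 * C' + 2 + 2 * k), by positivity, fun n D f hn hD hfn hf => ?_⟩
  have hn' : (2 : ℝ) ≤ n := by exact_mod_cast hn
  have hD' : (2 : ℝ) ≤ D := by exact_mod_cast hD
  have hk0 : (k : ℝ) ≠ 0 := by exact_mod_cast (by omega : k ≠ 0)
  have hf' : (f : ℝ) ^ k ≤ C * (D * n ^ (k - 1)) := by exact_mod_cast hf
  have hfg : (f : ℝ) ≤ C' * ((D : ℝ) ^ (1 / (k : ℝ)) * (n : ℝ) ^ (1 - 1 / (k : ℝ))) := by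
    have h1 : (f : ℝ) = ((f : ℝ) ^ k) ^ (1 / (k : ℝ)) := by
      rw [one_div, Real.pow_rpow_inv_natCast (by positivity) (by omega)]
    rw [h1]
    refine (Real.rpow_le_rpow (by positivity) hf' (by positivity)).trans (le_of_eq ?_)
    rw [Real.mul_rpow (by positivity) (by positivity), Real.mul_rpow (by positivity)
      (by positivity), ← Real.rpow_natCast (n : ℝ), ← Real.rpow_mul (by positivity),
      Nat.cast_sub (by omega), Nat.cast_one, sub_mul, mul_one_div_cancel hk0, one_mul]
  have h1 := sq_log_le hk (n := n) (D := D) (by linarith) (by linarith)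
  have h2 := log_mul_le hk hn' (by linarith : (1 : ℝ) ≤ D) (Nat.cast_nonneg f)
    (by exact_mod_cast hfn) hC0 hfg
  have h3 := clog_le_log (M := D * n) (by nlinarith)
  set g := (D : ℝ) ^ (1 / (k : ℝ)) * (n : ℝ) ^ (1 - 1 / (k : ℝ)) with hg
  have hg0 : 0 ≤ g := by positivity
  have hln : 1 / 2 ≤ Real.log n := by
    have := Real.log_le_log (by norm_num) hn'
    linarith [Real.log_two_gt_d9]
  push_cast at h3 ⊢
  set lam : ℝ := (Nat.clog 2 (D * n) : ℝ)
  have hlam : 0 ≤ lam := Nat.cast_nonneg _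
  have hf0 : (0 : ℝ) ≤ f := Nat.cast_nonneg f
  have h4 : lam * lam ≤ 9 * Real.log (D * n) ^ 2 := by nlinarith
  have h5 : lam * f ≤ 3 * (Real.log (D * n) * f) := by nlinarith
  have h6 : (k : ℝ) ^ 2 * g ≤ 2 * k ^ 2 * (g * Real.log n) := by
    have : 0 ≤ (k : ℝ) ^ 2 * g := by positivity
    nlinarith
  nlinarith

end MaxAnd

/-! ### Assembling the algorithm -/

namespace MaxAnd

lemma alphaStar_nonneg {k : ℕ} (hk : 2 ≤ k) : 0 ≤ alphaStar k := by
  have h : gammaK k ≤ 1 := by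
    rw [gammaK_eq hk]
    exact (div_le_one (by positivity)).2 (by linarith [(Nat.cast_nonneg (k / 2) : (0 : ℝ) ≤ _)])
  have h0 : 0 ≤ gammaK k := by
    rw [gammaK_eq hk]
    positivity
  have : 0 ≤ 1 - gammaK k := by linarith
  unfold alphaStar
  positivity

lemma obliviousValue_le_val {k n : ℕ} {r ρ : ℝ} (hr0 : 0 ≤ r) (hr1 : r ≤ 1) (Ψ : Instance k n)
    (h : Ψ ≠ []) : obliviousValue r ρ Ψ ≤ Ψ.val := by
  have : (0 : ℝ) < Ψ.length := by exact_mod_cast List.length_pos_iff.2 h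
  rw [obliviousValue, div_le_iff₀ this]
  exact sum_weight_le_val Ψ h (fun v => roundProb_nonneg hr0 hr1 _ _)
    fun v => roundProb_le_one hr0 hr1 _ _

lemma DualCert.mul_val_le_obliviousValue {k n : ℕ} {p ρ lam lam₀ α : ℝ}
    (hc : DualCert k p ρ lam lam₀ α) (Ψ : Instance k n) (h : Ψ ≠ []) :
    α * Ψ.val ≤ obliviousValue p ρ Ψ := by
  have : (0 : ℝ) < Ψ.length := by exact_mod_cast List.length_pos_iff.2 h
  rw [obliviousValue, le_div_iff₀ this, mul_assoc]
  exact hc.mul_val_le Ψ h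

lemma isEmpty_clause {k n : ℕ} (h : n < k) : IsEmpty (Clause k n) :=
  ⟨fun C => by
    have h1 := Finset.card_le_univ (vars C)
    rw [card_vars, Fintype.card_fin] at h1
    omega⟩

/-- A bounded-space algorithm for a fixed number `n` of variables. -/
def SolvableInSpace (k n : ℕ) (b : ℝ) (D : ℕ) (β : ℝ) : Prop :=
  ∃ (s : ℕ) (init : PMF (Fin s → Bool))
    (step : (Fin s → Bool) → Clause k n → PMF (Fin s → Bool)) (output : (Fin s → Bool) → ℝ),
    (s : ℝ) ≤ b ∧ ∀ Ψ : Instance k n, Ψ ≠ [] → Ψ.MaxDegreeLE D →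
      99 / 100 ≤ ((Ψ.foldl (fun μ C => μ.bind fun x => step x C) init).map output).toMeasure
        (Set.Icc (β * Ψ.val) Ψ.val)

lemma solvableInSpace_of_nonpos {k n D : ℕ} {b β : ℝ} (hb : 0 ≤ b) (hβ : β ≤ 0 ∨ n < k) :
    SolvableInSpace k n b D β := by
  refine ⟨0, PMF.pure fun _ => false, fun x _ => PMF.pure x, fun _ => 0, by simpa using hb,
    fun Ψ h _ => ?_⟩
  rcases hβ with hβ | hn
  · have hval : 0 ≤ Ψ.val := le_trans (by positivity) (half_pow_le_val Ψ h)
    have h1 : ∀ p : PMF (Fin 0 → Bool), p.map (fun _ => (0 : ℝ)) = PMF.pure 0 := fun p =>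
      PMF.map_const p 0
    rw [h1, PMF.toMeasure_pure, MeasureTheory.Measure.dirac_apply' _ measurableSet_Icc,
      Set.indicator_of_mem (Set.mem_Icc.2 ⟨mul_nonpos_of_nonpos_of_nonneg hβ hval, hval⟩)]
    simp only [Pi.one_apply]
    refine ENNReal.div_le_of_le_mul ?_
    norm_num
  · have := isEmpty_clause hn
    obtain ⟨C, -⟩ := List.exists_mem_of_ne_nil Ψ h
    exact isEmptyElim C

lemma exists_streamingAlgorithm {k D : ℕ} {b : ℕ → ℝ} {β : ℝ}
    (h : ∀ n, SolvableInSpace k n (b n) D β) : ∃ A : StreamingAlgorithm k,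
      (∀ n, (A.space n : ℝ) ≤ b n) ∧ ∀ (n : ℕ) (Ψ : Instance k n), Ψ ≠ [] → Ψ.MaxDegreeLE D →
        A.Approximates n Ψ β := by
  choose s init step output hs hA using h
  exact ⟨⟨s, init, step, output⟩, hs, hA⟩

end MaxAnd

theorem theorem4 (k : ℕ) (hk : 2 ≤ k) :
    ∃ α : ℝ, alphaStar k < α ∧ ∃ K : ℝ, 0 < K ∧
      ∀ ε : ℝ, 0 < ε → ∀ D : ℕ, 2 ≤ D →
        ∃ A : StreamingAlgorithm k,
          (∀ n : ℕ, (A.space n : ℝ) ≤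
            K * ((D : ℝ) ^ (1 / (k : ℝ)) * (n : ℝ) ^ (1 - 1 / (k : ℝ)) * Real.log (n : ℝ)
              / ε ^ (2 / (k : ℝ)))) ∧
          ∀ (n : ℕ) (Ψ : Instance k n), Ψ ≠ [] → Ψ.MaxDegreeLE D →
            A.Approximates n Ψ (α - ε) := by
  obtain ⟨r, ρ, lam, lam₀, α₀, hc, hα₀⟩ := MaxAnd.exists_dualCert hk
  have hstar := MaxAnd.alphaStar_nonneg hk
  -- The midpoint keeps half of the gap for the sampling error. As the value is at least 2^{-k}, the
  -- choice of δ makes 2δ at most that half gap times the value.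
  set α := (alphaStar k + α₀) / 2 with hα
  have hα0 : 0 < α := by linarith
  set δ := (α₀ - alphaStar k) / 4 * (1 / 2) ^ k with hδ
  have hδ0 : 0 < δ := mul_pos (by linarith) (by positivity)
  obtain ⟨G, K₁, hest⟩ := MaxAnd.exists_estimator hk hc.p_nonneg hc.p_le_one hδ0 (ρ := ρ)
  obtain ⟨K₂, hK₂, hsp⟩ := MaxAnd.exists_space_bound hk (2 ^ k * (2 * G * k + 1))
  refine ⟨α, by linarith, (K₁ + 1) * K₂ * α ^ (2 / (k : ℝ)), by positivity, fun ε hε D hD => ?_⟩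
  refine MaxAnd.exists_streamingAlgorithm fun n => ?_
  have hlog : 0 ≤ Real.log (n : ℝ) := Real.log_natCast_nonneg n
  -- For ε ≥ α the constant output 0 is good enough, and for n < k there are no clauses. Neither
  -- case uses memory, which covers n ≤ 1, where the bound contains log n = 0.
  rcases le_or_gt α ε with hαε | hαε
  · exact MaxAnd.solvableInSpace_of_nonpos (by positivity) (Or.inl (by linarith))
  rcases lt_or_ge n k with hnk | hnk
  · exact MaxAnd.solvableInSpace_of_nonpos (by positivity) (Or.inr hnk)
  obtain ⟨s, init, step, output, hs, hA⟩ := hest n D (by omega) hD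
  refine ⟨s, init, step, output, ?_, fun Ψ h0 hΨ => (hA Ψ h0 hΨ).trans
    (MeasureTheory.measure_mono (Set.Icc_subset_Icc ?_ ?_))⟩
  · have h1 := hsp n D _ (by omega) hD
      ((Nat.pow_le_pow_right (by norm_num) (Nat.sub_le _ _)).trans
        (Nat.pow_log_le_self 2 (by omega)))
      (MaxAnd.two_pow_sub_level_pow_le hk (G := G) (n := n) (D := D) (by omega) hD)
    set g := (D : ℝ) ^ (1 / (k : ℝ)) * (n : ℝ) ^ (1 - 1 / (k : ℝ)) * Real.log (n : ℝ) with hg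
    have hg0 : 0 ≤ g := by positivity
    have h2 : ε ^ (2 / (k : ℝ)) ≤ α ^ (2 / (k : ℝ)) :=
      Real.rpow_le_rpow hε.le hαε.le (by positivity)
    -- The algorithm does not depend on ε; for ε < α, dividing by ε^{2/k} only enlarges the
    -- allowance up to a constant factor.
    have h3 : g ≤ α ^ (2 / (k : ℝ)) * (g / ε ^ (2 / (k : ℝ))) := by
      rw [mul_div_assoc', le_div_iff₀ (Real.rpow_pos_of_pos hε _), mul_comm]
      exact mul_le_mul_of_nonneg_right h2 hg0
    calc (s : ℝ) ≤ K₁ * (K₂ * g) := by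
          refine le_trans (by exact_mod_cast hs) (mul_le_mul_of_nonneg_left h1 (by positivity))
      _ ≤ (K₁ + 1) * (K₂ * g) := by
          have : 0 ≤ K₂ * g := by positivity
          nlinarith
      _ ≤ (K₁ + 1) * (K₂ * (α ^ (2 / (k : ℝ)) * (g / ε ^ (2 / (k : ℝ))))) := by gcongr
      _ = _ := by ring
  · have h1 := hc.mul_val_le_obliviousValue Ψ h0
    have h2 := MaxAnd.half_pow_le_val Ψ h0
    have h3 : 2 * δ ≤ (α₀ - alphaStar k) / 2 * Ψ.val := by
      rw [hδ]
      have : 0 ≤ (α₀ - alphaStar k) / 2 := by linarith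
      nlinarith
    have h4 : 0 ≤ ε * Ψ.val := mul_nonneg hε.le (le_trans (by positivity) h2)
    rw [hα]
    linarith
  · exact MaxAnd.obliviousValue_le_val hc.p_nonneg hc.p_le_one Ψ h0
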